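/- Let $n\ge 6$ and let $M$ be a smooth $n$-dimensional manifold with a smooth (nondegenerate) metric $g_{ab}$ of any signature whose Weyl curvature tensor vanishes, $C_{abcd}=0$. Indices are raised and lowered with $g_{ab}$, a semicolon denotes the Levi-Civita covariant derivative (the index of differentiation is put last, so that $W_{abcd;ef}=\nabla_f\nabla_e W_{abcd}$), square brackets denote antisymmetrisation (with factor $1/k!$) over the enclosed upper, respectively lower, indices (also when they extend over several factors), and indices between vertical bars are excluded from it. The sign of the curvature is fixed by $V^a{}_{;cd}-V^a{}_{;dc}=R^a{}_{bcd}V^b$ and $R_{bd}=R^a{}_{bad}$ (so that round spheres have negative Ricci tensor), and $\tilde R_{ab}=R_{ab}-\frac1n R\,g_{ab}$ is the trace-free Ricci tensor, where $R=R^a{}_a$. Let $W_{abcd}$ be a Weyl candidate on $M$, i.e. a tensor field with $W_{abcd}=W_{[ab]cd}=W_{ab[cd]}$, $W_{abcd}=W_{cdab}$, $W_{a[bcd]}=0$ and $W^a{}_{bad}=0$. Consider the condition that $W_{abcd}$ is twice differentiable and that everywhere on $M$ $$\begin{aligned} W^{[ab}{}_{[cd;e]}{}^{f]}={}&\tfrac{1}{n-4}\,\delta^{[a}_{[c}W^{bf]}{}_{de];i}{}^{i}+\tfrac{2}{n-4}\,\delta^{[a}_{[c}W^{|i|b}{}_{de];i}{}^{f]}+\tfrac{2}{n-4}\,\delta^{[a}_{[c}W^{bf]}{}_{|i|d;e]}{}^{i}+\tfrac{4}{(n-3)(n-4)}\,\delta^{[a}_{[c}\delta^{b}_{d}W^{f]i}{}_{e]j;i}{}^{j}\\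 &-\tfrac{2}{n-2}\,W^{[a}{}_{[cd}{}^{b}\tilde R^{f]}{}_{e]}-\tfrac{4}{(n-2)(n-4)}\,\delta^{[a}_{[c}W^{b|i|f]}{}_{d}\tilde R_{e]i}-\tfrac{4}{(n-2)(n-4)}\,\delta^{[a}_{[c}W^{b}{}_{de]}{}^{|i|}\tilde R^{f]}{}_{i}\\ &-\tfrac{4}{(n-2)(n-3)(n-4)}\,\delta^{[a}_{[c}\delta^{b}_{d}W^{f]i}{}_{e]}{}^{j}\tilde R_{ij}. \end{aligned}$$ If $W_{abcd}$ fails to satisfy this condition, then there is no three times differentiable tensor field $L_{abc}$ on $M$ with $L_{abc}=L_{[ab]c}$ and $L_{[abc]}=0$ such that $$W^{ab}{}_{cd}=2L^{ab}{}_{[c;d]}+2L_{cd}{}^{[a;b]}-\tfrac{4}{n-2}\,\delta^{[a}_{[c}\Bigl(L^{b]}{}^{i}{}_{d];i}-L^{b]i}{}_{|i|;d]}+L_{d]i}{}^{b];i}-L_{d]i}{}^{|i|;b]}\Bigr)+\tfrac{8}{(n-2)(n-1)}\,\delta^{a}_{[c}\delta^{b}_{d]}L^{ij}{}_{i;j}.$$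 -/

import Mathlib

open scoped Manifold ContDiff

noncomputable section

namespace Lanczos

/-! ## Calculus of components in a coordinate domain -/

/-- The coordinate space `ℝⁿ`. -/
abbrev Coord (n : ℕ) : Type := EuclideanSpace ℝ (Fin n)

/-- The partial derivative `∂f/∂xⁱ` at `y`. -/
def partialDeriv {n : ℕ} (i : Fin n) (f : Coord n → ℝ) (y : Coord n) : ℝ :=
  fderiv ℝ f y (EuclideanSpace.single i 1)

/-- `f` is `k` times differentiable on the open set `s` (no continuity of the `k`-th derivatives is
asked for): `f` is differentiable on `s` in the sense of Fréchet, and all its first partial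
derivatives are `k - 1` times differentiable on `s`. -/
def TimesDifferentiableOn {n : ℕ} : ℕ → (Coord n → ℝ) → Set (Coord n) → Prop
  | 0, _, _ => True
  | k + 1, f, s =>
      DifferentiableOn ℝ f s ∧ ∀ i : Fin n, TimesDifferentiableOn k (partialDeriv i f) s

/-- The components `T_{i₁ … iₖ}` of a covariant tensor field of rank `k` in a chart, as functions of
the coordinates. -/
abbrev Components (n k : ℕ) : Type := (Fin k → Fin n) → Coord n → ℝ

section Components

variable {n : ℕ}

/-- The matrix `g_{ij}` of the metric at `y`. -/
def metricMatrix (G : Components n 2) (y : Coord n) : Matrix (Fin n) (Fin n) ℝ :=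
  Matrix.of fun i j => G ![i, j] y

/-- The inverse metric `g^{ij}` at `y`. -/
def invMetric (G : Components n 2) (y : Coord n) (i j : Fin n) : ℝ := (metricMatrix G y)⁻¹ i j

/-- The contraction `g^{ij} F_{ij}` at `y`. -/
def contract (G : Components n 2) (y : Coord n) (F : Fin n → Fin n → ℝ) : ℝ :=
  ∑ i, ∑ j, invMetric G y i j * F i j

/-- The Christoffel symbol `Γ^c_{ab}` of the metric with components `G`. -/
def christoffel (G : Components n 2) (c a b : Fin n) (y : Coord n) : ℝ :=
  (1 / 2) * ∑ d, invMetric G y c d *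
    (partialDeriv a (G ![d, b]) y + partialDeriv b (G ![d, a]) y - partialDeriv d (G ![a, b]) y)

/-- The Levi-Civita covariant derivative `T_{i₁ … iₖ ; d}` of a covariant tensor field; the index
of differentiation is put last, so that `covD G (covD G T)` has the components
`T_{i₁ … iₖ ; d e}`. -/
def covD (G : Components n 2) {k : ℕ} (T : Components n k) : Components n (k + 1) :=
  fun I y =>
    partialDeriv (I (Fin.last k)) (T (Fin.init I)) y -
      ∑ j : Fin k, ∑ m : Fin n, christoffel G m (I (Fin.last k)) (I j.castSucc) y *
        T (Function.update (Fin.init I) j m) y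

/-- The curvature tensor `R^a_{bcd}`, with the sign convention
`V^a_{;cd} - V^a_{;dc} = R^a_{bcd} V^b`. -/
def riemannUp (G : Components n 2) (a b c d : Fin n) (y : Coord n) : ℝ :=
  partialDeriv d (christoffel G a c b) y - partialDeriv c (christoffel G a d b) y +
    ∑ m, (christoffel G a d m y * christoffel G m c b y -
      christoffel G a c m y * christoffel G m d b y)

/-- The curvature tensor `R_{abcd} = g_{am} R^m_{bcd}`. -/
def riemann (G : Components n 2) (a b c d : Fin n) (y : Coord n) : ℝ :=
  ∑ m, G ![a, m] y * riemannUp G m b c d y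

/-- The Ricci tensor `R_{bd} = R^a_{bad}`. With this sign convention it is negative
definite on round spheres. -/
def ricci (G : Components n 2) (b d : Fin n) (y : Coord n) : ℝ := ∑ a, riemannUp G a b a d y

/-- The scalar curvature `R = g^{bd} R_{bd}`. -/
def scalarCurv (G : Components n 2) (y : Coord n) : ℝ := contract G y fun b d => ricci G b d y

/-- The trace-free Ricci tensor `R_{ab} - (R / n) g_{ab}`. -/
def tfRicci (G : Components n 2) (a b : Fin n) (y : Coord n) : ℝ :=
  ricci G a b y - scalarCurv G y / n * G ![a, b] y

/-- The Weyl curvature tensor `C_{abcd}`. -/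
def weyl (G : Components n 2) (a b c d : Fin n) (y : Coord n) : ℝ :=
  riemann G a b c d y
    - 1 / ((n : ℝ) - 2) *
      (G ![a, c] y * ricci G b d y - G ![a, d] y * ricci G b c y
        - G ![b, c] y * ricci G a d y + G ![b, d] y * ricci G a c y)
    + scalarCurv G y / (((n : ℝ) - 1) * ((n : ℝ) - 2)) *
      (G ![a, c] y * G ![b, d] y - G ![a, d] y * G ![b, c] y)

/-- Antisymmetrisation `F_{[ab]}`, with the weight `1/2!`. -/
def asym2 (F : Fin n → Fin n → ℝ) (a b : Fin n) : ℝ := (F a b - F b a) / 2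

/-- Antisymmetrisation `F_{[abc]}`, with the weight `1/3!`. -/
def asym3 (F : Fin n → Fin n → Fin n → ℝ) (a b c : Fin n) : ℝ :=
  (F a b c + F b c a + F c a b - F b a c - F a c b - F c b a) / 6

/-- The equation which expresses `W` through the potential `L`, at the point `y`, with all indices
lowered:
`W_{abcd} = 2 L_{ab[c;d]} + 2 L_{cd[a;b]} - 4/(n-2) g_{[a[c} S_{b]d]}
  + 8/((n-2)(n-1)) g_{a[c} g_{|b|d]} L^{ij}_{i;j}`, where the antisymmetrisations in the third
term are over `a, b` and over `c, d`, and
`S_{bd} = L_b^i_{d;i} - L_b^i_{i;d} + L_{dib}^{;i} - L_{di}^i_{;b}`. -/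
def PotentialEquationAt (G : Components n 2) (L : Components n 3) (W : Components n 4)
    (y : Coord n) : Prop :=
  let D : Components n 4 := covD G L
  let S : Fin n → Fin n → ℝ := fun b d =>
    contract G y (fun i j => D ![b, i, d, j] y) - contract G y (fun i j => D ![b, i, j, d] y)
      + contract G y (fun i j => D ![d, i, b, j] y) - contract G y (fun i j => D ![d, i, j, b] y)
  ∀ a b c d : Fin n,
    W ![a, b, c, d] y =
      2 * asym2 (fun c d => D ![a, b, c, d] y) c d
      + 2 * asym2 (fun a b => D ![c, d, a, b] y) a b
      - 4 / ((n : ℝ) - 2) *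
        asym2 (fun a b => asym2 (fun c d => G ![a, c] y * S b d) c d) a b
      + 8 / (((n : ℝ) - 2) * ((n : ℝ) - 1)) *
        asym2 (fun c d => G ![a, c] y * G ![b, d] y) c d *
        contract G y (fun i k => contract G y fun j l => D ![i, j, k, l] y)

/-- The second order condition on `W` at the point `y`, with all indices lowered. Both sides are
antisymmetrised over `a, b, f` and over `c, d, e`. -/
def SecondOrderConditionAt (G : Components n 2) (W : Components n 4) (y : Coord n) : Prop :=
  let DDW : Components n 6 := covD G (covD G W)
  let N : ℝ := n
  let g : Fin n → Fin n → ℝ := fun a b => G ![a, b] y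
  let Ric : Fin n → Fin n → ℝ := fun a b => tfRicci G a b y
  let lhs : Fin n → Fin n → Fin n → Fin n → Fin n → Fin n → ℝ := fun a b f c d e =>
    DDW ![a, b, c, d, e, f] y
  let rhs : Fin n → Fin n → Fin n → Fin n → Fin n → Fin n → ℝ := fun a b f c d e =>
    1 / (N - 4) * g a c * contract G y (fun i j => DDW ![b, f, d, e, i, j] y)
    + 2 / (N - 4) * g a c * contract G y (fun i j => DDW ![i, b, d, e, j, f] y)
    + 2 / (N - 4) * g a c * contract G y (fun i j => DDW ![b, f, i, d, e, j] y)
    + 4 / ((N - 3) * (N - 4)) * g a c * g b d *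
        contract G y (fun i k => contract G y fun j l => DDW ![f, i, e, j, k, l] y)
    - 2 / (N - 2) * W ![a, c, d, b] y * Ric f e
    - 4 / ((N - 2) * (N - 4)) * g a c * contract G y (fun i j => W ![b, i, f, d] y * Ric e j)
    - 4 / ((N - 2) * (N - 4)) * g a c * contract G y (fun i j => W ![b, d, e, i] y * Ric f j)
    - 4 / ((N - 2) * (N - 3) * (N - 4)) * g a c * g b d *
        contract G y (fun i k => contract G y fun j l => W ![f, i, e, j] y * Ric k l)
  ∀ a b f c d e : Fin n,
    asym3 (fun a b f => asym3 (fun c d e => lhs a b f c d e) c d e) a b f =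
      asym3 (fun a b f => asym3 (fun c d e => rhs a b f c d e) c d e) a b f

end Components

/-! ## Tensor fields on a manifold -/

section Manifold

variable {n : ℕ} {M : Type*} [TopologicalSpace M] [ChartedSpace (EuclideanSpace ℝ (Fin n)) M]

variable (n M) in
/-- A (not necessarily continuous) covariant tensor field of rank `k` on the `n`-manifold `M`. -/
abbrev CovTensorField (k : ℕ) : Type _ :=
  (x : M) → MultilinearMap ℝ (fun _ : Fin k => TangentSpace (𝓡 n) x) ℝ

variable (n M) in
/-- The smooth charts of `M`. -/
abbrev smoothCharts : Set (OpenPartialHomeomorph M (EuclideanSpace ℝ (Fin n))) :=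
  IsManifold.maximalAtlas (𝓡 n) ∞ M

/-- The coordinate vector field `∂/∂xⁱ` of a chart, at the point with coordinates `y`. -/
def coordVector (e : OpenPartialHomeomorph M (EuclideanSpace ℝ (Fin n))) (y : Coord n)
    (i : Fin n) : TangentSpace (𝓡 n) (e.symm y) :=
  mfderiv (𝓡 n) (𝓡 n) e.symm y (EuclideanSpace.single i (1 : ℝ) : EuclideanSpace ℝ (Fin n))

/-- The components `T_{i₁ … iₖ} = T(∂_{i₁}, …, ∂_{iₖ})` of a tensor field in a chart (meaningful
on the target of the chart). -/
def CovTensorField.comp {k : ℕ} (T : CovTensorField n M k)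
    (e : OpenPartialHomeomorph M (EuclideanSpace ℝ (Fin n))) : Components n k :=
  fun I y => T (e.symm y) fun j => coordVector e y (I j)

/-- A tensor field is `r` times differentiable if its components in all smooth charts are. -/
def CovTensorField.TimesDifferentiable {k : ℕ} (T : CovTensorField n M k) (r : ℕ) : Prop :=
  ∀ e ∈ smoothCharts n M, ∀ I : Fin k → Fin n, TimesDifferentiableOn r (T.comp e I) e.target

variable (n M) in
/-- A smooth metric of arbitrary signature: a symmetric, nondegenerate, smooth covariant tensor
field of rank two. -/
structure Metric where
  /-- The tensor field `g_{ab}`. -/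
  val : CovTensorField n M 2
  symm : ∀ (x : M) (u v : TangentSpace (𝓡 n) x), val x ![u, v] = val x ![v, u]
  nondegenerate : ∀ (x : M) (u : TangentSpace (𝓡 n) x),
    (∀ v : TangentSpace (𝓡 n) x, val x ![u, v] = 0) → u = 0
  smooth : ∀ e ∈ smoothCharts n M, ∀ I : Fin 2 → Fin n,
    ContDiffOn ℝ ∞ (val.comp e I) e.target

/-- The Weyl curvature tensor of the metric vanishes identically. -/
def Metric.WeylVanishes (g : Metric n M) : Prop :=
  ∀ e ∈ smoothCharts n M, ∀ y ∈ e.target, ∀ a b c d : Fin n, weyl (g.val.comp e) a b c d y = 0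

/-- `W` is a Weyl candidate: a 4-tensor with the algebraic symmetries of the Weyl tensor. -/
structure IsWeylCandidate (g : Metric n M) (W : CovTensorField n M 4) : Prop where
  antisymm_left : ∀ (x : M) (u v w z : TangentSpace (𝓡 n) x),
    W x ![u, v, w, z] = -W x ![v, u, w, z]
  antisymm_right : ∀ (x : M) (u v w z : TangentSpace (𝓡 n) x),
    W x ![u, v, w, z] = -W x ![u, v, z, w]
  pair_symm : ∀ (x : M) (u v w z : TangentSpace (𝓡 n) x), W x ![u, v, w, z] = W x ![w, z, u, v]
  cyclic : ∀ (x : M) (u v w z : TangentSpace (𝓡 n) x),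
    W x ![u, v, w, z] + W x ![u, w, z, v] + W x ![u, z, v, w] = 0
  trace_free : ∀ e ∈ smoothCharts n M, ∀ y ∈ e.target, ∀ b d : Fin n,
    contract (g.val.comp e) y (fun i j => W.comp e ![i, b, j, d] y) = 0

/-- The algebraic symmetries `L_{abc} = L_{[ab]c}` and `L_{[abc]} = 0` of a Lanczos potential. -/
structure HasLanczosSymmetries (L : CovTensorField n M 3) : Prop where
  antisymm : ∀ (x : M) (u v w : TangentSpace (𝓡 n) x), L x ![u, v, w] = -L x ![v, u, w]
  cyclic : ∀ (x : M) (u v w : TangentSpace (𝓡 n) x),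
    L x ![u, v, w] + L x ![v, w, u] + L x ![w, u, v] = 0

/-- `W` is given by the potential `L`. -/
def IsGivenBy (g : Metric n M) (W : CovTensorField n M 4) (L : CovTensorField n M 3) : Prop :=
  ∀ e ∈ smoothCharts n M, ∀ y ∈ e.target,
    PotentialEquationAt (g.val.comp e) (L.comp e) (W.comp e) y

/-- `W` satisfies the second order condition on `M`: it has second derivatives, and the equation
holds everywhere. -/
def SatisfiesSecondOrderCondition (g : Metric n M) (W : CovTensorField n M 4) : Prop :=
  W.TimesDifferentiable 2 ∧
    ∀ e ∈ smoothCharts n M, ∀ y ∈ e.target, SecondOrderConditionAt (g.val.comp e) (W.comp e) y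

end Manifold

end Lanczos

end

/-!
A potential `L` of a Weyl candidate `W` forces the second order condition, so that a `W` which
fails the condition has no potential. Both are statements about components in charts; the chart
domain is an open subset `U` of the coordinate space with a smooth nondegenerate metric `G`
(`IsMetricOn`), and `Metric.isMetricOn` supplies these from a metric on the manifold.

The argument works modulo trace terms. Call an array with three upper indices `a b f` and three
lower indices `c d e` (all written as lower ones) negligible if its antisymmetrisation over `a b f`
and over `c d e` is that of some `g_{ac} X_{bfde}`. It is negligible as soon as every linear
functional with `IsAltModTrace` vanishes on it (`exists_alt_eq_metric_mul`), so that identities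
modulo negligible arrays become linear relations between the values of such a functional.

*The second derivative of `W` modulo trace terms.* The equation for the potential says that
`W_{abcd} = L_{abc;d} - L_{abd;c} + L_{cda;b} - L_{cdb;a}` up to a product of the metric with a
tensor of rank two (`exists_trace_part`). Hence `W_{abcd;ef}` is `2 L_{abc;def} + 2 L_{cda;bef}`
modulo negligible arrays. Each summand contains the antisymmetrisation of two derivatives, which
the Ricci identity turns into curvature. As the Weyl tensor vanishes, the curvature is the product
of the metric with the Schouten tensor `P` (`riemann_eq_of_weyl_eq_zero`), and `2 L_{abc;def}`
becomes `-4 P_{ae} L_{dbc;f}` (`map_third_derivative`). The terms with derivatives of `P` are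
negligible because `P_{ab;c} - P_{ac;b}` is a trace term, by the contracted second Bianchi identity
(`exists_covD_schouten_sub_eq`). In the sum the derivatives of `L` recombine to `W`:
`W_{abcd;ef} + 2 P_{fe} W_{acdb}` is negligible (`map_second_derivative`).

*The trace terms.* By the cyclic identity, `-2 W_{acdb}` may be replaced here by `W_{abcd}`, and `P`
by the trace-free Ricci tensor divided by `n - 2`. Thus the antisymmetrisation of
`Q_{abcdef} = W_{abcd;ef} - W_{abcd} R_{ef} / (n - 2)`, with `R_{ef}` the trace-free Ricci tensor,
is that of `g_{ac} X_{bfde}` for some `X` which is antisymmetric in `b, f` and in `d, e`. Its trace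
is a multiple of `(n - 4) X` plus products of the metric with the trace of `X`, its double trace is
a multiple of `(n - 3)` times the trace of `X` plus a multiple of the metric, and its triple trace
vanishes. So `X` can be solved for in terms of the traces of `Q` (`alt_eq_of_alt_eq_metric_mul`),
and the result is the second order condition (`secondOrderConditionAt_of_altModTrace`).

Derivatives are only assumed to exist, not to be continuous. That second partial derivatives
commute nevertheless is `partialDeriv_comm`.
-/

noncomputable section

namespace Lanczos

/-! ### Partial derivatives and repeated differentiability -/

section PartialDerivatives

variable {n : ℕ} {U : Set (Coord n)} {f g : Coord n → ℝ} {y : Coord n}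

theorem partialDeriv_congr (hU : IsOpen U) (h : Set.EqOn f g U) (hy : y ∈ U) (i : Fin n) :
    partialDeriv i f y = partialDeriv i g y := by
  unfold partialDeriv
  rw [(h.eventuallyEq_of_mem (hU.mem_nhds hy)).fderiv_eq]

theorem partialDeriv_const (i : Fin n) (c : ℝ) : partialDeriv i (fun _ => c) y = 0 := by
  simp [partialDeriv]

theorem partialDeriv_add (hf : DifferentiableAt ℝ f y) (hg : DifferentiableAt ℝ g y) (i : Fin n) :
    partialDeriv i (fun z => f z + g z) y = partialDeriv i f y + partialDeriv i g y := by
  simp [partialDeriv, fderiv_fun_add hf hg]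

theorem partialDeriv_sub (hf : DifferentiableAt ℝ f y) (hg : DifferentiableAt ℝ g y) (i : Fin n) :
    partialDeriv i (fun z => f z - g z) y = partialDeriv i f y - partialDeriv i g y := by
  simp [partialDeriv, fderiv_fun_sub hf hg]

theorem partialDeriv_mul (hf : DifferentiableAt ℝ f y) (hg : DifferentiableAt ℝ g y) (i : Fin n) :
    partialDeriv i (fun z => f z * g z) y =
      partialDeriv i f y * g y + f y * partialDeriv i g y := by
  simp [partialDeriv, fderiv_fun_mul hf hg]; ring

theorem partialDeriv_const_mul (c : ℝ) (hf : DifferentiableAt ℝ f y) (i : Fin n) :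
    partialDeriv i (fun z => c * f z) y = c * partialDeriv i f y := by
  simp [partialDeriv, fderiv_const_mul hf]

theorem partialDeriv_sum {ι : Type*} (s : Finset ι) {F : ι → Coord n → ℝ}
    (hF : ∀ k ∈ s, DifferentiableAt ℝ (F k) y) (i : Fin n) :
    partialDeriv i (fun z => ∑ k ∈ s, F k z) y = ∑ k ∈ s, partialDeriv i (F k) y := by
  simp [partialDeriv, fderiv_fun_sum hF]

end PartialDerivatives

namespace TimesDifferentiableOn

variable {n k : ℕ} {U : Set (Coord n)} {f g : Coord n → ℝ}

theorem partialDeriv (h : TimesDifferentiableOn (k + 1) f U) (i : Fin n) :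
    TimesDifferentiableOn k (partialDeriv i f) U := h.2 i

theorem congr (hU : IsOpen U) (hf : TimesDifferentiableOn k f U) (h : Set.EqOn g f U) :
    TimesDifferentiableOn k g U := by
  induction k generalizing f g with
  | zero => trivial
  | succ k ih =>
    exact ⟨hf.1.congr h, fun i => ih (hf.2 i) fun y hy => partialDeriv_congr hU h hy i⟩

theorem of_succ (hf : TimesDifferentiableOn (k + 1) f U) : TimesDifferentiableOn k f U := by
  induction k generalizing f with
  | zero => trivial
  | succ k ih => exact ⟨hf.1, fun i => ih (hf.2 i)⟩

theorem const (c : ℝ) : TimesDifferentiableOn k (fun _ : Coord n => c) U := by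
  induction k generalizing c with
  | zero => trivial
  | succ k ih =>
    refine ⟨differentiableOn_const c, fun i => ?_⟩
    rw [show Lanczos.partialDeriv i (fun _ : Coord n => c) = fun _ => 0 from
      funext fun y => partialDeriv_const i c]
    exact ih 0

theorem add (hU : IsOpen U) (hf : TimesDifferentiableOn k f U) (hg : TimesDifferentiableOn k g U) :
    TimesDifferentiableOn k (fun y => f y + g y) U := by
  induction k generalizing f g with
  | zero => trivial
  | succ k ih =>
    exact ⟨hf.1.add hg.1, fun i => (ih (hf.2 i) (hg.2 i)).congr hU fun y hy =>
      partialDeriv_add (hf.1.differentiableAt (hU.mem_nhds hy))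
        (hg.1.differentiableAt (hU.mem_nhds hy)) i⟩

theorem mul (hU : IsOpen U) (hf : TimesDifferentiableOn k f U) (hg : TimesDifferentiableOn k g U) :
    TimesDifferentiableOn k (fun y => f y * g y) U := by
  induction k generalizing f g with
  | zero => trivial
  | succ k ih =>
    exact ⟨hf.1.mul hg.1, fun i =>
      (add hU (ih (hf.2 i) hg.of_succ) (ih hf.of_succ (hg.2 i))).congr hU fun y hy =>
      partialDeriv_mul (hf.1.differentiableAt (hU.mem_nhds hy))
        (hg.1.differentiableAt (hU.mem_nhds hy)) i⟩

theorem const_mul (hU : IsOpen U) (c : ℝ) (hf : TimesDifferentiableOn k f U) :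
    TimesDifferentiableOn k (fun y => c * f y) U :=
  mul hU (const c) hf

theorem sub (hU : IsOpen U) (hf : TimesDifferentiableOn k f U) (hg : TimesDifferentiableOn k g U) :
    TimesDifferentiableOn k (fun y => f y - g y) U :=
  (add hU hf (const_mul hU (-1) hg)).congr hU fun y _ => by ring

theorem sum (hU : IsOpen U) {ι : Type*} (s : Finset ι) {F : ι → Coord n → ℝ}
    (hF : ∀ j ∈ s, TimesDifferentiableOn k (F j) U) :
    TimesDifferentiableOn k (fun y => ∑ j ∈ s, F j y) U := by
  classical
  induction s using Finset.induction_on with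
  | empty => simpa using const 0
  | insert a s ha ih =>
    simp only [Finset.sum_insert ha]
    exact add hU (hF a (by simp)) (ih fun j hj => hF j (by simp [hj]))

theorem of_contDiffOn (hU : IsOpen U) (hf : ContDiffOn ℝ ∞ f U) : TimesDifferentiableOn k f U := by
  induction k generalizing f with
  | zero => trivial
  | succ k ih =>
    refine ⟨hf.differentiableOn (by simp), fun i => ih ?_⟩
    exact (hf.fderiv_of_isOpen hU (m := ∞) (by simp)).clm_apply contDiffOn_const

end TimesDifferentiableOn

/-- Partial derivatives of a twice differentiable function commute, also when the second
derivatives are not continuous. -/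
theorem partialDeriv_comm {n : ℕ} {U : Set (Coord n)} {f : Coord n → ℝ} {y : Coord n}
    (hU : IsOpen U) (hf : TimesDifferentiableOn 2 f U) (hy : y ∈ U) (i j : Fin n) :
    partialDeriv i (partialDeriv j f) y = partialDeriv j (partialDeriv i f) y := by
  have hfd : ∀ᶠ z in nhds y, HasFDerivAt f (fderiv ℝ f z) z := by
    filter_upwards [hU.mem_nhds hy] with z hz
    exact (hf.1.differentiableAt (hU.mem_nhds hz)).hasFDerivAt
  -- The derivative is the combination of the coordinate covectors with the partial derivatives as
  -- coefficients, hence itself differentiable.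
  have hexp : ∀ z, fderiv ℝ f z =
      ∑ k, partialDeriv k f z • (EuclideanSpace.proj k : Coord n →L[ℝ] ℝ) := by
    intro z
    ext v
    have hv : v = ∑ k, v k • (EuclideanSpace.single k (1 : ℝ) : Coord n) := by
      ext l
      simp [Finset.sum_apply, Pi.single_apply]
    conv_lhs => rw [hv]
    simp [partialDeriv, mul_comm]
  have hd : DifferentiableAt ℝ (fderiv ℝ f) y := by
    rw [show fderiv ℝ f = fun z => ∑ k, partialDeriv k f z •
      (EuclideanSpace.proj k : Coord n →L[ℝ] ℝ) from funext hexp]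
    refine DifferentiableAt.fun_sum fun k _ => ?_
    exact ((hf.2 k).1.differentiableAt (hU.mem_nhds hy)).smul_const _
  have hs := second_derivative_symmetric_of_eventually hfd hd.hasFDerivAt
    (EuclideanSpace.single i 1) (EuclideanSpace.single j 1)
  have key : ∀ k l : Fin n, partialDeriv k (partialDeriv l f) y =
      fderiv ℝ (fderiv ℝ f) y (EuclideanSpace.single k 1) (EuclideanSpace.single l 1) := by
    intro k l
    have : HasFDerivAt (partialDeriv l f) ((ContinuousLinearMap.apply ℝ ℝ
        (EuclideanSpace.single l (1 : ℝ) : Coord n)).comp (fderiv ℝ (fderiv ℝ f) y)) y :=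
      ((ContinuousLinearMap.apply ℝ ℝ (EuclideanSpace.single l (1 : ℝ) : Coord n)).hasFDerivAt
        (x := fderiv ℝ f y)).comp y hd.hasFDerivAt
    simp only [partialDeriv] at this ⊢
    rw [this.fderiv]; rfl
  rw [key, key, hs]

/-! ### The metric and its Levi-Civita connection -/

/-- The components `G` are those of a smooth, symmetric and nondegenerate metric on the open set
`U` of the coordinate space. -/
structure IsMetricOn {n : ℕ} (G : Components n 2) (U : Set (Coord n)) : Prop where
  isOpen : IsOpen U
  contDiffOn : ∀ I, ContDiffOn ℝ ∞ (G I) U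
  symm : ∀ y ∈ U, ∀ a b, G ![a, b] y = G ![b, a] y
  isUnit_det : ∀ y ∈ U, IsUnit (metricMatrix G y).det

namespace IsMetricOn

variable {n : ℕ} {G : Components n 2} {U : Set (Coord n)} {y : Coord n}

theorem differentiableAt_of (hG : IsMetricOn G U) {k : ℕ} {f : Coord n → ℝ}
    (hf : TimesDifferentiableOn (k + 1) f U) (hy : y ∈ U) : DifferentiableAt ℝ f y :=
  hf.1.differentiableAt (hG.isOpen.mem_nhds hy)

theorem timesDifferentiableOn (hG : IsMetricOn G U) (k : ℕ) (I : Fin 2 → Fin n) :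
    TimesDifferentiableOn k (G I) U :=
  .of_contDiffOn hG.isOpen (hG.contDiffOn I)

/-- The relation `g_{ab} g^{bc} = δ_a^c`. -/
theorem sum_metric_mul_invMetric (hG : IsMetricOn G U) (hy : y ∈ U) (a c : Fin n) :
    ∑ b, G ![a, b] y * invMetric G y b c = if a = c then 1 else 0 := by
  have := congrFun (congrFun (Matrix.mul_nonsing_inv _ (hG.isUnit_det y hy)) a) c
  rw [Matrix.mul_apply, Matrix.one_apply] at this
  exact this

theorem sum_invMetric_mul_metric (hG : IsMetricOn G U) (hy : y ∈ U) (a c : Fin n) :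
    ∑ b, invMetric G y a b * G ![b, c] y = if a = c then 1 else 0 := by
  have := congrFun (congrFun (Matrix.nonsing_inv_mul _ (hG.isUnit_det y hy)) a) c
  rw [Matrix.mul_apply, Matrix.one_apply] at this
  exact this

theorem invMetric_symm (hG : IsMetricOn G U) (hy : y ∈ U) (a b : Fin n) :
    invMetric G y a b = invMetric G y b a := by
  have hs : (metricMatrix G y).transpose = metricMatrix G y := by
    ext i j
    exact hG.symm y hy j i
  have : ((metricMatrix G y)⁻¹).transpose = (metricMatrix G y)⁻¹ := by
    rw [Matrix.transpose_nonsing_inv, hs]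
  exact congrFun (congrFun this b) a

theorem contDiffOn_invMetric (hG : IsMetricOn G U) (a b : Fin n) :
    ContDiffOn ℝ ∞ (fun y => invMetric G y a b) U := by
  have hdet : ∀ A : Coord n → Matrix (Fin n) (Fin n) ℝ, (∀ i j, ContDiffOn ℝ ∞ (fun y => A y i j) U)
      → ContDiffOn ℝ ∞ (fun y => (A y).det) U := by
    intro A hA
    simp only [Matrix.det_apply']
    exact ContDiffOn.sum fun σ _ => contDiffOn_const.mul (contDiffOn_prod fun i _ => hA _ _)
  have hm : ∀ i j, ContDiffOn ℝ ∞ (fun y => metricMatrix G y i j) U :=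
    fun i j => hG.contDiffOn ![i, j]
  have h : ∀ y ∈ U, invMetric G y a b =
      (metricMatrix G y).det⁻¹ * ((metricMatrix G y).updateRow b (Pi.single a 1)).det := by
    intro y hy
    rw [invMetric, Matrix.inv_def, Matrix.smul_apply, Matrix.adjugate_apply, smul_eq_mul,
      Ring.inverse_eq_inv']
  refine ContDiffOn.congr (ContDiffOn.mul ?_ ?_) h
  · exact (hdet _ hm).inv fun y hy => (hG.isUnit_det y hy).ne_zero
  · refine hdet _ fun i j => ?_
    by_cases hi : i = b
    · subst hi; simp only [Matrix.updateRow_self]; exact contDiffOn_const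
    · simp only [Matrix.updateRow_ne hi]; exact hm i j

theorem timesDifferentiableOn_invMetric (hG : IsMetricOn G U) (k : ℕ) (a b : Fin n) :
    TimesDifferentiableOn k (fun y => invMetric G y a b) U :=
  .of_contDiffOn hG.isOpen (hG.contDiffOn_invMetric a b)

theorem timesDifferentiableOn_christoffel (hG : IsMetricOn G U) (k : ℕ) (c a b : Fin n) :
    TimesDifferentiableOn k (christoffel G c a b) U := by
  have h : ∀ i I, TimesDifferentiableOn k (partialDeriv i (G I)) U :=
    fun i I => (hG.timesDifferentiableOn (k + 1) I).partialDeriv i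
  exact .const_mul hG.isOpen _ (.sum hG.isOpen _ fun d _ =>
    .mul hG.isOpen (hG.timesDifferentiableOn_invMetric k c d)
      (.sub hG.isOpen (.add hG.isOpen (h _ _) (h _ _)) (h _ _)))

theorem partialDeriv_metric_symm (hG : IsMetricOn G U) (hy : y ∈ U) (i a b : Fin n) :
    partialDeriv i (G ![a, b]) y = partialDeriv i (G ![b, a]) y :=
  partialDeriv_congr hG.isOpen (fun z hz => hG.symm z hz a b) hy i

theorem christoffel_symm (hG : IsMetricOn G U) (hy : y ∈ U) (c a b : Fin n) :
    christoffel G c a b y = christoffel G c b a y := by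
  simp only [christoffel]
  congr 1
  refine Finset.sum_congr rfl fun d _ => ?_
  rw [hG.partialDeriv_metric_symm hy d a b]
  ring

/-- The Christoffel symbols of the first kind. -/
theorem sum_metric_mul_christoffel (hG : IsMetricOn G U) (hy : y ∈ U) (e a b : Fin n) :
    ∑ c, G ![e, c] y * christoffel G c a b y = (1 / 2) *
      (partialDeriv a (G ![e, b]) y + partialDeriv b (G ![e, a]) y - partialDeriv e (G ![a, b]) y) := by
  have h : ∀ X : Fin n → ℝ, ∑ c, G ![e, c] y * ((1 / 2) * ∑ d, invMetric G y c d * X d) =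
      (1 / 2) * X e := by
    intro X
    calc _ = (1 / 2) * ∑ d, (∑ c, G ![e, c] y * invMetric G y c d) * X d := by
          simp only [Finset.mul_sum, Finset.sum_mul]
          rw [Finset.sum_comm]
          exact Finset.sum_congr rfl fun d _ => Finset.sum_congr rfl fun c _ => by ring
      _ = _ := by simp [hG.sum_metric_mul_invMetric hy]
  exact h _

/-- The Levi-Civita connection is metric. -/
theorem partialDeriv_metric (hG : IsMetricOn G U) (hy : y ∈ U) (d a b : Fin n) :
    partialDeriv d (G ![a, b]) y = ∑ m, christoffel G m d a y * G ![m, b] y +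
      ∑ m, christoffel G m d b y * G ![a, m] y := by
  have h1 := hG.sum_metric_mul_christoffel hy b d a
  have h2 := hG.sum_metric_mul_christoffel hy a d b
  have e1 : ∑ m, christoffel G m d a y * G ![m, b] y =
      ∑ c, G ![b, c] y * christoffel G c d a y :=
    Finset.sum_congr rfl fun m _ => by rw [hG.symm y hy m b]; ring
  have e2 : ∑ m, christoffel G m d b y * G ![a, m] y =
      ∑ c, G ![a, c] y * christoffel G c d b y :=
    Finset.sum_congr rfl fun m _ => by ring
  rw [e1, e2, h1, h2, hG.partialDeriv_metric_symm hy d b a, hG.partialDeriv_metric_symm hy b d a,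
    hG.partialDeriv_metric_symm hy a d b]
  ring

/-- The inverse metric is parallel, too. -/
theorem partialDeriv_invMetric (hG : IsMetricOn G U) (hy : y ∈ U) (d a b : Fin n) :
    partialDeriv d (fun z => invMetric G z a b) y =
      - ∑ m, christoffel G a d m y * invMetric G y m b
      - ∑ m, christoffel G b d m y * invMetric G y a m := by
  -- Differentiate `h * g = 1`, and multiply by `h` from the right.
  have hh : ∀ i j, DifferentiableAt ℝ (fun z => invMetric G z i j) y := fun i j =>
    hG.differentiableAt_of (hG.timesDifferentiableOn_invMetric 1 i j) hy
  have hg : ∀ I, DifferentiableAt ℝ (G I) y := fun I =>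
    hG.differentiableAt_of (hG.timesDifferentiableOn 1 I) hy
  set Γ : Matrix (Fin n) (Fin n) ℝ := Matrix.of fun c b => christoffel G c d b y with hΓ
  set H : Matrix (Fin n) (Fin n) ℝ := Matrix.of fun i j => invMetric G y i j with hH
  set g : Matrix (Fin n) (Fin n) ℝ := Matrix.of fun i j => G ![i, j] y with hgdef
  set H' : Matrix (Fin n) (Fin n) ℝ :=
    Matrix.of fun i j => partialDeriv d (fun z => invMetric G z i j) y with hH'
  have hgH : g * H = 1 := by
    ext i j
    rw [Matrix.mul_apply, Matrix.one_apply]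
    exact hG.sum_metric_mul_invMetric hy i j
  have hHg : H * g = 1 := by
    ext i j
    rw [Matrix.mul_apply, Matrix.one_apply]
    exact hG.sum_invMetric_mul_metric hy i j
  have hder : H' * g + H * (Γ.transpose * g + g * Γ) = 0 := by
    ext i j
    have h0 : partialDeriv d (fun z => ∑ k, invMetric G z i k * G ![k, j] z) y = 0 := by
      rw [partialDeriv_congr (g := fun _ => if i = j then 1 else 0) hG.isOpen
        (fun z hz => hG.sum_invMetric_mul_metric hz i j) hy, partialDeriv_const]
    rw [partialDeriv_sum _ (fun k _ => (hh i k).fun_mul (hg _))] at h0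
    simp only [Matrix.add_apply, Matrix.mul_apply, Matrix.zero_apply, ← Finset.sum_add_distrib]
    rw [← h0]
    refine Finset.sum_congr rfl fun k _ => ?_
    rw [partialDeriv_mul (hh i k) (hg _), hG.partialDeriv_metric hy]
    simp [hΓ, hH, hgdef, hH', Finset.sum_add_distrib, mul_comm]
  have hfin : H' = - (Γ * H) - H * Γ.transpose := by
    have h1 : (H' * g + H * (Γ.transpose * g + g * Γ)) * H =
        H' * (g * H) + H * Γ.transpose * (g * H) + (H * g) * Γ * H := by noncomm_ring
    rw [hder, hgH, hHg] at h1
    simp only [zero_mul, mul_one, one_mul] at h1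
    rw [← sub_eq_zero, h1]; abel
  have := congrFun (congrFun hfin a) b
  simpa [hH', hH, hΓ, Matrix.mul_apply, mul_comm] using this

end IsMetricOn

/-! ### Covariant derivatives of tensor fields -/

/-- The tensor field with components `T` is differentiable on `U`, and its covariant derivative
there has the components `T'`. -/
structure HasCovDOn {n : ℕ} (G : Components n 2) (U : Set (Coord n)) {k : ℕ} (T : Components n k)
    (T' : Components n (k + 1)) : Prop where
  differentiableOn : ∀ I, DifferentiableOn ℝ (T I) U
  covD_eq : ∀ y ∈ U, ∀ J, covD G T J y = T' J y

section CovD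

variable {n k : ℕ} {G : Components n 2} {U : Set (Coord n)} {y : Coord n}

theorem covD_congr (hU : IsOpen U) {S T : Components n k} (h : ∀ y ∈ U, ∀ I, S I y = T I y)
    (hy : y ∈ U) (J : Fin (k + 1) → Fin n) : covD G S J y = covD G T J y := by
  unfold covD
  rw [partialDeriv_congr hU (fun z hz => h z hz _) hy]
  simp only [h y hy]

theorem timesDifferentiableOn_covD (hG : IsMetricOn G U) {r : ℕ} {T : Components n k}
    (hT : ∀ I, TimesDifferentiableOn (r + 1) (T I) U) (J : Fin (k + 1) → Fin n) :
    TimesDifferentiableOn r (covD G T J) U :=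
  .sub hG.isOpen ((hT _).partialDeriv _) (.sum hG.isOpen _ fun _ _ => .sum hG.isOpen _ fun _ _ =>
    .mul hG.isOpen (hG.timesDifferentiableOn_christoffel r _ _ _) (hT _).of_succ)

theorem hasCovDOn {r : ℕ} {T : Components n k}
    (hT : ∀ I, TimesDifferentiableOn (r + 1) (T I) U) : HasCovDOn G U T (covD G T) :=
  ⟨fun I => (hT I).1, fun _ _ _ => rfl⟩

namespace HasCovDOn

variable {S T : Components n k} {S' T' : Components n (k + 1)}

theorem congr (hU : IsOpen U) (hT : HasCovDOn G U T T') (h : ∀ y ∈ U, ∀ I, S I y = T I y) :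
    HasCovDOn G U S T' :=
  ⟨fun I => (hT.differentiableOn I).congr fun y hy => h y hy I,
    fun y hy J => (covD_congr hU h hy J).trans (hT.covD_eq y hy J)⟩

theorem add (hU : IsOpen U) (hS : HasCovDOn G U S S') (hT : HasCovDOn G U T T') :
    HasCovDOn G U (fun I y => S I y + T I y) (fun J y => S' J y + T' J y) := by
  refine ⟨fun I => (hS.differentiableOn I).add (hT.differentiableOn I), fun y hy J => ?_⟩
  rw [← hS.covD_eq y hy, ← hT.covD_eq y hy]
  have hd := fun {F : Coord n → ℝ} (h : DifferentiableOn ℝ F U) =>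
    h.differentiableAt (hU.mem_nhds hy)
  unfold covD
  rw [partialDeriv_add (hd (hS.differentiableOn _)) (hd (hT.differentiableOn _))]
  simp only [mul_add, Finset.sum_add_distrib]
  ring

theorem const_mul (hU : IsOpen U) (c : ℝ) (hT : HasCovDOn G U T T') :
    HasCovDOn G U (fun I y => c * T I y) (fun J y => c * T' J y) := by
  refine ⟨fun I => (hT.differentiableOn I).const_mul c, fun y hy J => ?_⟩
  rw [← hT.covD_eq y hy]
  unfold covD
  rw [partialDeriv_const_mul c ((hT.differentiableOn _).differentiableAt (hU.mem_nhds hy)), mul_sub,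
    Finset.mul_sum]
  simp only [Finset.mul_sum, mul_left_comm]

theorem sub (hU : IsOpen U) (hS : HasCovDOn G U S S') (hT : HasCovDOn G U T T') :
    HasCovDOn G U (fun I y => S I y - T I y) (fun J y => S' J y - T' J y) := by
  simpa [sub_eq_add_neg] using hS.add hU (hT.const_mul hU (-1))

/-- The product rule for a tensor product `A ⊗ B` whose indices are distributed over the `k` slots
by `σ` and `τ`; the index of differentiation is appended by `σ'` and `τ'`. -/
theorem mul {p q : ℕ} (hU : IsOpen U) {A : Components n p} {B : Components n q}
    {A' : Components n (p + 1)} {B' : Components n (q + 1)}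
    (hA : HasCovDOn G U A A') (hB : HasCovDOn G U B B') (σ : Fin p → Fin k) (τ : Fin q → Fin k)
    (σ₀ : Fin p → Fin (k + 1)) (τ₀ : Fin q → Fin (k + 1))
    (σ' : Fin (p + 1) → Fin (k + 1)) (τ' : Fin (q + 1) → Fin (k + 1))
    (hbij : Function.Bijective (Sum.elim σ τ) := by decide)
    (hσ₀ : σ₀ = Fin.castSucc ∘ σ := by decide) (hτ₀ : τ₀ = Fin.castSucc ∘ τ := by decide)
    (hσ' : σ' = Fin.snoc (α := fun _ => Fin (k + 1)) (Fin.castSucc ∘ σ) (Fin.last k) := by decide)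
    (hτ' : τ' = Fin.snoc (α := fun _ => Fin (k + 1)) (Fin.castSucc ∘ τ) (Fin.last k) := by decide) :
    HasCovDOn G U (fun I y => A (I ∘ σ) y * B (I ∘ τ) y)
      (fun J y => A' (J ∘ σ') y * B (J ∘ τ₀) y + A (J ∘ σ₀) y * B' (J ∘ τ') y) := by
  subst hσ' hτ' hσ₀ hτ₀
  refine ⟨fun I => (hA.differentiableOn _).mul (hB.differentiableOn _), fun y hy J => ?_⟩
  rw [← hA.covD_eq y hy, ← hB.covD_eq y hy]
  have hσ : Function.Injective σ := fun a b h => by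
    simpa using hbij.1 (a₁ := Sum.inl a) (a₂ := Sum.inl b) h
  have hτ : Function.Injective τ := fun a b h => by
    simpa using hbij.1 (a₁ := Sum.inr a) (a₂ := Sum.inr b) h
  have hστ : ∀ i j, σ i ≠ τ j := fun i j h => by
    simpa using hbij.1 (a₁ := Sum.inl i) (a₂ := Sum.inr j) h
  have h1 : ∀ i m (I : Fin k → Fin n), Function.update I (σ i) m ∘ σ =
      Function.update (I ∘ σ) i m := fun i m I => Function.update_comp_eq_of_injective _ hσ _ _
  have h2 : ∀ i m (I : Fin k → Fin n), Function.update I (τ i) m ∘ τ =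
      Function.update (I ∘ τ) i m := fun i m I => Function.update_comp_eq_of_injective _ hτ _ _
  have h3 : ∀ i m (I : Fin k → Fin n), Function.update I (σ i) m ∘ τ = I ∘ τ := fun i m I =>
    funext fun j => Function.update_of_ne (hστ i j).symm _ _
  have h4 : ∀ i m (I : Fin k → Fin n), Function.update I (τ i) m ∘ σ = I ∘ σ := fun i m I =>
    funext fun j => Function.update_of_ne (hστ j i) _ _
  have hsum : ∀ f : Fin k → ℝ, ∑ j, f j = ∑ i, f (σ i) + ∑ i, f (τ i) := fun f => by
    rw [← (Equiv.ofBijective _ hbij).sum_comp, Fintype.sum_sum_type]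
    rfl
  have hd := fun {F : Coord n → ℝ} (h : DifferentiableOn ℝ F U) =>
    h.differentiableAt (hU.mem_nhds hy)
  have hinit : ∀ {r : ℕ} (ρ : Fin r → Fin k), Fin.init (J ∘ Fin.snoc (α := fun _ => Fin (k + 1))
      (Fin.castSucc ∘ ρ) (Fin.last k)) = Fin.init J ∘ ρ := fun ρ => by
    ext i; simp [Fin.init]
  unfold covD
  rw [partialDeriv_mul (hd (hA.differentiableOn _)) (hd (hB.differentiableOn _)), hsum]
  simp only [h1, h2, h3, h4, hinit]
  simp only [Function.comp_apply, Fin.snoc_last, Fin.snoc_castSucc]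
  have e1 : (Fin.init J ∘ σ) = J ∘ Fin.castSucc ∘ σ := rfl
  have e2 : (Fin.init J ∘ τ) = J ∘ Fin.castSucc ∘ τ := rfl
  rw [e1, e2]
  simp only [sub_mul, mul_sub, Finset.sum_mul, Finset.mul_sum, mul_assoc, mul_left_comm]
  ring

/-- A permutation of the indices commutes with covariant differentiation; `σ'` extends `σ` by the
index of differentiation. -/
theorem reindex (hT : HasCovDOn G U T T') (σ : Fin k → Fin k) (σ' : Fin (k + 1) → Fin (k + 1))
    (hbij : Function.Bijective σ := by decide)
    (hσ' : σ' = Fin.snoc (α := fun _ => Fin (k + 1)) (Fin.castSucc ∘ σ) (Fin.last k) := by decide) :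
    HasCovDOn G U (fun I y => T (I ∘ σ) y) (fun J y => T' (J ∘ σ') y) := by
  subst hσ'
  refine ⟨fun I => hT.differentiableOn _, fun y hy J => ?_⟩
  rw [← hT.covD_eq y hy]
  have h1 : ∀ i m (I : Fin k → Fin n), Function.update I (σ i) m ∘ σ =
      Function.update (I ∘ σ) i m := fun i m I =>
    Function.update_comp_eq_of_injective _ hbij.1 _ _
  have hinit : Fin.init (J ∘ Fin.snoc (α := fun _ => Fin (k + 1)) (Fin.castSucc ∘ σ) (Fin.last k)) =
      Fin.init J ∘ σ := by
    ext i; simp [Fin.init]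
  unfold covD
  rw [← (Equiv.ofBijective _ hbij).sum_comp]
  simp only [Equiv.ofBijective_apply, h1, hinit]
  simp only [Function.comp_apply, Fin.snoc_last, Fin.snoc_castSucc]

end HasCovDOn

/-- The metric is parallel. -/
theorem hasCovDOn_metric (hG : IsMetricOn G U) : HasCovDOn G U G (fun _ _ => 0) := by
  refine ⟨fun I => (hG.timesDifferentiableOn 1 I).1, fun y hy J => ?_⟩
  have hJ : Fin.init J = ![J 0, J 1] := by
    ext i; fin_cases i <;> rfl
  have u0 : ∀ m : Fin n, Function.update ![J 0, J 1] 0 m = ![m, J 1] := fun m => by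
    ext i; fin_cases i <;> rfl
  have u1 : ∀ m : Fin n, Function.update ![J 0, J 1] 1 m = ![J 0, m] := fun m => by
    ext i; fin_cases i <;> rfl
  unfold covD
  rw [hJ, hG.partialDeriv_metric hy, Fin.sum_univ_two]
  simp only [u0, u1]
  exact sub_self _

/-- The product rule for the tensor product with the metric. -/
theorem HasCovDOn.metric_mul {q : ℕ} (hG : IsMetricOn G U) {B : Components n q}
    {B' : Components n (q + 1)} (hB : HasCovDOn G U B B') (σ : Fin 2 → Fin k) (τ : Fin q → Fin k)
    (σ₀ : Fin 2 → Fin (k + 1)) (τ' : Fin (q + 1) → Fin (k + 1))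
    (hbij : Function.Bijective (Sum.elim σ τ) := by decide)
    (hσ₀ : σ₀ = Fin.castSucc ∘ σ := by decide)
    (hτ' : τ' = Fin.snoc (α := fun _ => Fin (k + 1)) (Fin.castSucc ∘ τ) (Fin.last k) := by decide) :
    HasCovDOn G U (fun I y => G (I ∘ σ) y * B (I ∘ τ) y)
      (fun J y => G (J ∘ σ₀) y * B' (J ∘ τ') y) := by
  simpa using (hasCovDOn_metric hG).mul hG.isOpen hB σ τ σ₀ _ _ τ' hbij hσ₀ rfl rfl hτ'

/-- Covariant differentiation preserves the vanishing of a trace. -/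
theorem sum_invMetric_covD_eq_zero (hG : IsMetricOn G U) {T : Components n k}
    (hT : ∀ I, DifferentiableOn ℝ (T I) U) {p q : Fin k} (hpq : p ≠ q)
    (h : ∀ y ∈ U, ∀ I, ∑ i, ∑ j, invMetric G y i j *
      T (Function.update (Function.update I p i) q j) y = 0) (hy : y ∈ U)
    (J : Fin (k + 1) → Fin n) :
    ∑ i, ∑ j, invMetric G y i j *
      covD G T (Function.update (Function.update J p.castSucc i) q.castSucc j) y = 0 := by
  classical
  set I := Fin.init J with hI
  set d := J (Fin.last k) with hd
  have hinit : ∀ i j, Fin.init (Function.update (Function.update J p.castSucc i) q.castSucc j) =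
      Function.update (Function.update I p i) q j := fun i j => by
    rw [Fin.init_update_castSucc, Fin.init_update_castSucc]
  have hlast : ∀ i j, Function.update (Function.update J p.castSucc i) q.castSucc j (Fin.last k) =
      d := fun i j => by
    rw [Function.update_of_ne (Fin.castSucc_lt_last q).ne', Function.update_of_ne
      (Fin.castSucc_lt_last p).ne']
  have hcs : ∀ i j r, Function.update (Function.update J p.castSucc i) q.castSucc j
      (Fin.castSucc r) = Function.update (Function.update I p i) q j r := fun i j r => by
    rw [← hinit]; rfl
  have hda : ∀ I, DifferentiableAt ℝ (T I) y := fun I =>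
    (hT I).differentiableAt (hG.isOpen.mem_nhds hy)
  have hdh : ∀ i j, DifferentiableAt ℝ (fun z => invMetric G z i j) y := fun i j =>
    hG.differentiableAt_of (hG.timesDifferentiableOn_invMetric 1 i j) hy
  set t : Fin n → Fin n → ℝ := fun i j => T (Function.update (Function.update I p i) q j) y with ht
  have h0 : ∑ i, ∑ j, (partialDeriv d (fun z => invMetric G z i j) y * t i j +
      invMetric G y i j *
        partialDeriv d (T (Function.update (Function.update I p i) q j)) y) = 0 := by
    have : partialDeriv d (fun z => ∑ i, ∑ j, invMetric G z i j *
        T (Function.update (Function.update I p i) q j) z) y = 0 := by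
      rw [partialDeriv_congr (g := fun _ => 0) hG.isOpen (fun z hz => h z hz I) hy,
        partialDeriv_const]
    rw [partialDeriv_sum _ fun i _ => DifferentiableAt.fun_sum fun j _ =>
      (hdh i j).fun_mul (hda _)] at this
    rw [← this]
    refine Finset.sum_congr rfl fun i _ => ?_
    rw [partialDeriv_sum _ fun j _ => (hdh i j).fun_mul (hda _)]
    exact Finset.sum_congr rfl fun j _ => (partialDeriv_mul (hdh i j) (hda _) d).symm
  -- Only the slots `p` and `q` contribute Christoffel terms: in the others, the trace is one of `T`.
  have hslots : ∑ i, ∑ j, invMetric G y i j * (∑ r, ∑ m,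
      christoffel G m d (Function.update (Function.update I p i) q j r) y *
        T (Function.update (Function.update (Function.update I p i) q j) r m) y) =
      ∑ i, ∑ j, invMetric G y i j *
        (∑ m, christoffel G m d i y * t m j + ∑ m, christoffel G m d j y * t i m) := by
    have hr : ∀ r, r ≠ p → r ≠ q → ∑ i, ∑ j, invMetric G y i j * (∑ m,
        christoffel G m d (Function.update (Function.update I p i) q j r) y *
        T (Function.update (Function.update (Function.update I p i) q j) r m) y) = 0 := by
      intro r hrp hrq
      have : ∀ i j m, Function.update (Function.update (Function.update I p i) q j) r m =
          Function.update (Function.update (Function.update I r m) p i) q j := fun i j m => by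
        rw [Function.update_comm hrq.symm, Function.update_comm hrp.symm]
      simp only [this, Function.update_of_ne hrp, Function.update_of_ne hrq, Finset.mul_sum]
      calc _ = ∑ m, christoffel G m d (I r) y * ∑ i, ∑ j, invMetric G y i j *
            T (Function.update (Function.update (Function.update I r m) p i) q j) y := by
            simp only [Finset.mul_sum]
            rw [Finset.sum_comm_cycle]
            refine Finset.sum_congr rfl fun m _ => Finset.sum_congr rfl fun i _ =>
              Finset.sum_congr rfl fun j _ => mul_left_comm _ _ _
        _ = 0 := by simp [h y hy]
    have hsplit : ∀ i j, (∑ r, ∑ m,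
      christoffel G m d (Function.update (Function.update I p i) q j r) y *
        T (Function.update (Function.update (Function.update I p i) q j) r m) y) =
        (∑ m, christoffel G m d i y * t m j + ∑ m, christoffel G m d j y * t i m) +
        ∑ r ∈ Finset.univ \ {p, q}, ∑ m,
      christoffel G m d (Function.update (Function.update I p i) q j r) y *
        T (Function.update (Function.update (Function.update I p i) q j) r m) y := by
      intro i j
      rw [← Finset.sum_sdiff (Finset.subset_univ {p, q}), Finset.sum_pair hpq, add_comm]
      congr 1
      congr 1
      · refine Finset.sum_congr rfl fun m _ => ?_
        rw [Function.update_of_ne hpq, Function.update_self, Function.update_comm hpq.symm,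
          Function.update_idem]
      · refine Finset.sum_congr rfl fun m _ => ?_
        rw [Function.update_self, Function.update_idem]
    simp only [hsplit]
    simp only [mul_add _ (_ + _) (Finset.sum _ _), Finset.sum_add_distrib]
    rw [add_eq_left]
    calc _ = ∑ r ∈ Finset.univ \ {p, q}, ∑ i, ∑ j, invMetric G y i j * (∑ m,
        christoffel G m d (Function.update (Function.update I p i) q j r) y *
        T (Function.update (Function.update (Function.update I p i) q j) r m) y) := by
          simp only [Finset.mul_sum (s := Finset.univ \ {p, q})]
          exact Finset.sum_comm_cycle
      _ = 0 := Finset.sum_eq_zero fun r hr' => hr r (by simp_all) (by simp_all)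
  simp only [covD, hinit, hlast, hcs, mul_sub, Finset.sum_sub_distrib]
  rw [hslots]
  simp only [Finset.sum_add_distrib] at h0
  simp only [hG.partialDeriv_invMetric hy] at h0
  rw [← h0]
  have c1 : ∑ i, ∑ j, invMetric G y i j * ∑ m, christoffel G m d i y * t m j =
      ∑ i, ∑ j, (∑ m, christoffel G i d m y * invMetric G y m j) * t i j := by
    simp only [Finset.mul_sum, Finset.sum_mul]
    rw [Finset.sum_comm_cycle]
    refine Finset.sum_congr rfl fun m _ => ?_
    rw [Finset.sum_comm]
    exact Finset.sum_congr rfl fun j _ => Finset.sum_congr rfl fun i _ => by ring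
  have c2 : ∑ i, ∑ j, invMetric G y i j * ∑ m, christoffel G m d j y * t i m =
      ∑ i, ∑ j, (∑ m, christoffel G j d m y * invMetric G y i m) * t i j := by
    simp only [Finset.mul_sum, Finset.sum_mul]
    refine Finset.sum_congr rfl fun i _ => ?_
    rw [Finset.sum_comm]
    exact Finset.sum_congr rfl fun j _ => Finset.sum_congr rfl fun m _ => by ring
  simp only [mul_add, sub_mul, neg_mul, Finset.sum_add_distrib, Finset.sum_sub_distrib,
    Finset.sum_neg_distrib, c1, c2]
  ring

end CovD

/-! ### The Ricci identity and the first Bianchi identity -/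

section Curvature

variable {n k : ℕ} {G : Components n 2} {U : Set (Coord n)} {y : Coord n}

theorem covD_snoc (T : Components n k) (I : Fin k → Fin n) (d : Fin n) (y : Coord n) :
    covD G T (Fin.snoc I d) y = partialDeriv d (T I) y -
      ∑ j, ∑ m, christoffel G m d (I j) y * T (Function.update I j m) y := by
  simp [covD]

/-- The second covariant derivative, up to terms which are symmetric in the two indices of
differentiation `d` and `e`. -/
theorem exists_covD_covD_eq (hG : IsMetricOn G U) {T : Components n k}
    (hT : ∀ I, TimesDifferentiableOn 2 (T I) U) (hy : y ∈ U) (I : Fin k → Fin n) :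
    ∃ s : Fin n → Fin n → ℝ, (∀ d e, s d e = s e d) ∧ ∀ d e,
      covD G (covD G T) (Fin.snoc (Fin.snoc I d) e) y = s d e -
        ∑ j, ∑ m, (partialDeriv e (christoffel G m d (I j)) y -
          ∑ p, christoffel G p e (I j) y * christoffel G m d p y) *
            T (Function.update I j m) y := by
  classical
  have hd1 : ∀ I, DifferentiableAt ℝ (T I) y := fun I => hG.differentiableAt_of (hT I) hy
  have hd2 : ∀ i I, DifferentiableAt ℝ (partialDeriv i (T I)) y := fun i I =>
    hG.differentiableAt_of ((hT I).partialDeriv i) hy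
  have hdΓ : ∀ a b c, DifferentiableAt ℝ (christoffel G a b c) y := fun a b c =>
    hG.differentiableAt_of (hG.timesDifferentiableOn_christoffel 1 a b c) hy
  -- In order: the second partial derivatives, the products of a Christoffel symbol with a first
  -- derivative, the products of Christoffel symbols on two different slots, and the Christoffel
  -- term of the index `d`.
  refine ⟨fun d e => partialDeriv e (partialDeriv d (T I)) y
      - (∑ j, ∑ m, christoffel G m d (I j) y * partialDeriv e (T (Function.update I j m)) y
        + ∑ j, ∑ m, christoffel G m e (I j) y * partialDeriv d (T (Function.update I j m)) y)
      + (∑ j, ∑ l ∈ Finset.univ.erase j, ∑ p, ∑ m, christoffel G p e (I j) y *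
          christoffel G m d (I l) y * T (Function.update (Function.update I j p) l m) y)
      - ∑ m, christoffel G m e d y * covD G T (Fin.snoc I m) y, fun d e => ?_, fun d e => ?_⟩
  · have h1 := partialDeriv_comm hG.isOpen (hT I) hy e d
    have h2 : (∑ j, ∑ l ∈ Finset.univ.erase j, ∑ p, ∑ m, christoffel G p e (I j) y *
          christoffel G m d (I l) y * T (Function.update (Function.update I j p) l m) y) =
        ∑ j, ∑ l ∈ Finset.univ.erase j, ∑ p, ∑ m, christoffel G p d (I j) y *
          christoffel G m e (I l) y * T (Function.update (Function.update I j p) l m) y := by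
      rw [Finset.sum_comm' (s := Finset.univ) (t' := Finset.univ)
        (s' := fun j => Finset.univ.erase j) (by simp [eq_comm])]
      refine Finset.sum_congr rfl fun j _ => Finset.sum_congr rfl fun l hl => ?_
      rw [Finset.sum_comm]
      refine Finset.sum_congr rfl fun m _ => Finset.sum_congr rfl fun p _ => ?_
      rw [Function.update_comm (Finset.ne_of_mem_erase hl)]
      ring
    have h3 : ∀ m, christoffel G m e d y = christoffel G m d e y := fun m =>
      hG.christoffel_symm hy m e d
    simp only [h1, h2, h3]
    ring
  · have hdΓT : ∀ j m, DifferentiableAt ℝ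
        (fun z => christoffel G m d (I j) z * T (Function.update I j m) z) y := fun j m =>
      (hdΓ _ _ _).fun_mul (hd1 _)
    have hder : partialDeriv e (covD G T (Fin.snoc I d)) y =
        partialDeriv e (partialDeriv d (T I)) y -
        ∑ j, ∑ m, (partialDeriv e (christoffel G m d (I j)) y * T (Function.update I j m) y +
          christoffel G m d (I j) y * partialDeriv e (T (Function.update I j m)) y) := by
      rw [show covD G T (Fin.snoc I d) = fun z => partialDeriv d (T I) z -
        ∑ j, ∑ m, christoffel G m d (I j) z * T (Function.update I j m) z from
        funext fun z => covD_snoc T I d z]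
      rw [partialDeriv_sub (hd2 _ _) (DifferentiableAt.fun_sum fun j _ =>
          DifferentiableAt.fun_sum fun m _ => hdΓT j m),
        partialDeriv_sum _ (fun j _ => DifferentiableAt.fun_sum fun m _ => hdΓT j m)]
      congr 1
      refine Finset.sum_congr rfl fun j _ => ?_
      rw [partialDeriv_sum _ fun m _ => hdΓT j m]
      exact Finset.sum_congr rfl fun m _ => partialDeriv_mul (hdΓ _ _ _) (hd1 _) e
    rw [covD_snoc, hder, Fin.sum_univ_castSucc]
    simp only [Fin.snoc_castSucc, Fin.snoc_last, Fin.update_snoc_last, ← Fin.snoc_update]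
    have hquad : ∀ j, (∑ p, christoffel G p e (I j) y * ∑ l, ∑ m,
          christoffel G m d (Function.update I j p l) y *
            T (Function.update (Function.update I j p) l m) y) =
        (∑ m, (∑ p, christoffel G p e (I j) y * christoffel G m d p y) *
          T (Function.update I j m) y) +
        ∑ l ∈ Finset.univ.erase j, ∑ p, ∑ m, christoffel G p e (I j) y *
          christoffel G m d (I l) y * T (Function.update (Function.update I j p) l m) y := by
      intro j
      have : ∀ p, (∑ l, ∑ m, christoffel G m d (Function.update I j p l) y *
            T (Function.update (Function.update I j p) l m) y) =
          (∑ m, christoffel G m d p y * T (Function.update I j m) y) +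
          ∑ l ∈ Finset.univ.erase j, ∑ m, christoffel G m d (I l) y *
            T (Function.update (Function.update I j p) l m) y := by
        intro p
        rw [← Finset.add_sum_erase _ _ (Finset.mem_univ j)]
        simp only [Function.update_self, Function.update_idem]
        congr 1
        refine Finset.sum_congr rfl fun l hl => ?_
        simp only [Function.update_of_ne (Finset.ne_of_mem_erase hl)]
      simp only [this, mul_add, Finset.sum_add_distrib, Finset.mul_sum, Finset.sum_mul, ← mul_assoc]
      congr 1 <;> rw [Finset.sum_comm]
    simp only [covD_snoc, mul_sub, sub_mul, Finset.sum_sub_distrib, Finset.sum_add_distrib, hquad]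
    ring

/-- The Ricci identity. -/
theorem covD_covD_sub_covD_covD (hG : IsMetricOn G U) {T : Components n k}
    (hT : ∀ I, TimesDifferentiableOn 2 (T I) U) (hy : y ∈ U) (I : Fin k → Fin n) (d e : Fin n) :
    covD G (covD G T) (Fin.snoc (Fin.snoc I d) e) y -
      covD G (covD G T) (Fin.snoc (Fin.snoc I e) d) y =
      - ∑ j, ∑ m, riemannUp G m (I j) d e y * T (Function.update I j m) y := by
  obtain ⟨s, hs, h⟩ := exists_covD_covD_eq hG hT hy I
  rw [h, h, hs d e]
  have : ∀ j, ∑ m, riemannUp G m (I j) d e y * T (Function.update I j m) y =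
      ∑ m, (partialDeriv e (christoffel G m d (I j)) y -
          ∑ p, christoffel G p e (I j) y * christoffel G m d p y) * T (Function.update I j m) y -
      ∑ m, (partialDeriv d (christoffel G m e (I j)) y -
          ∑ p, christoffel G p d (I j) y * christoffel G m e p y) *
            T (Function.update I j m) y := by
    intro j
    rw [← Finset.sum_sub_distrib]
    refine Finset.sum_congr rfl fun m _ => ?_
    rw [riemannUp, Finset.sum_sub_distrib]
    simp only [mul_comm (christoffel G _ _ (I j) y)]
    ring
  simp only [this, Finset.sum_sub_distrib]
  ring

theorem riemannUp_antisymm (a b c d : Fin n) :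
    riemannUp G a b c d y = - riemannUp G a b d c y := by
  simp only [riemannUp, Finset.sum_sub_distrib]
  ring

/-- The first Bianchi identity. -/
theorem riemannUp_cyclic (hG : IsMetricOn G U) (hy : y ∈ U) (a b c d : Fin n) :
    riemannUp G a b c d y + riemannUp G a c d b y + riemannUp G a d b c y = 0 := by
  have h1 : ∀ i a b c, partialDeriv i (christoffel G a b c) y =
      partialDeriv i (christoffel G a c b) y := fun i a b c =>
    partialDeriv_congr hG.isOpen (fun z hz => hG.christoffel_symm hz a b c) hy i
  simp only [riemannUp, Finset.sum_sub_distrib]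
  simp only [h1 _ _ c b, h1 _ _ d c, h1 _ _ d b, hG.christoffel_symm hy _ c b,
    hG.christoffel_symm hy _ d c, hG.christoffel_symm hy _ d b]
  ring

end Curvature

/-! ### The second Bianchi identity -/

section Bianchi

variable {n : ℕ} {G : Components n 2} {U : Set (Coord n)} {y : Coord n}

theorem timesDifferentiableOn_riemannUp (hG : IsMetricOn G U) (r : ℕ) (a b c d : Fin n) :
    TimesDifferentiableOn r (riemannUp G a b c d) U := by
  have h := hG.timesDifferentiableOn_christoffel
  exact .add hG.isOpen (.sub hG.isOpen ((h (r + 1) _ _ _).partialDeriv _)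
    ((h (r + 1) _ _ _).partialDeriv _)) (.sum hG.isOpen _ fun m _ => .sub hG.isOpen
      (.mul hG.isOpen (h r _ _ _) (h r _ _ _)) (.mul hG.isOpen (h r _ _ _) (h r _ _ _)))

/-- The second Bianchi identity `R^a_{b[cd;e]} = 0`. The connection terms for the indices `c`, `d`,
`e` cancel in the cyclic sum, and are left out. -/
theorem partialDeriv_riemannUp_cyclic (hG : IsMetricOn G U) (hy : y ∈ U) (a b c d e : Fin n) :
    (partialDeriv e (riemannUp G a b c d) y +
        ∑ m, christoffel G a e m y * riemannUp G m b c d y -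
        ∑ m, christoffel G m e b y * riemannUp G a m c d y) +
      (partialDeriv c (riemannUp G a b d e) y +
        ∑ m, christoffel G a c m y * riemannUp G m b d e y -
        ∑ m, christoffel G m c b y * riemannUp G a m d e y) +
      (partialDeriv d (riemannUp G a b e c) y +
        ∑ m, christoffel G a d m y * riemannUp G m b e c y -
        ∑ m, christoffel G m d b y * riemannUp G a m e c y) = 0 := by
  -- In terms of the matrices `Γ_i` and `R_{cd} = ∂_d Γ_c - ∂_c Γ_d + Γ_d Γ_c - Γ_c Γ_d`, this is
  -- the vanishing of the cyclic sum of `∂_e R_{cd} + Γ_e R_{cd} - R_{cd} Γ_e`.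
  set Γ : Fin n → Matrix (Fin n) (Fin n) ℝ := fun i => Matrix.of fun a b => christoffel G a i b y
  set D : Fin n → Fin n → Matrix (Fin n) (Fin n) ℝ := fun i j =>
    Matrix.of fun a b => partialDeriv i (christoffel G a j b) y
  set DD : Fin n → Fin n → Fin n → Matrix (Fin n) (Fin n) ℝ := fun i j k =>
    Matrix.of fun a b => partialDeriv i (partialDeriv j (christoffel G a k b)) y
  have hdΓ : ∀ a b c, DifferentiableAt ℝ (christoffel G a b c) y := fun a b c =>
    hG.differentiableAt_of (hG.timesDifferentiableOn_christoffel 1 a b c) hy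
  have hdD : ∀ i a b c, DifferentiableAt ℝ (partialDeriv i (christoffel G a b c)) y :=
    fun i a b c =>
    hG.differentiableAt_of ((hG.timesDifferentiableOn_christoffel 2 a b c).partialDeriv i) hy
  have hDD : ∀ i j k, DD i j k = DD j i k := fun i j k => by
    ext a b
    exact partialDeriv_comm hG.isOpen (hG.timesDifferentiableOn_christoffel 2 a k b) hy i j
  have hR : ∀ c d, (Matrix.of fun a b => riemannUp G a b c d y) =
      D d c - D c d + (Γ d * Γ c - Γ c * Γ d) := fun c d => by
    ext a b
    simp [riemannUp, D, Γ, Matrix.mul_apply]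
  have hDR : ∀ c d e, (Matrix.of fun a b => partialDeriv e (riemannUp G a b c d) y) =
      DD e d c - DD e c d +
        (D e d * Γ c + Γ d * D e c - (D e c * Γ d + Γ c * D e d)) := fun c d e => by
    ext a b
    have h1 : ∀ m, DifferentiableAt ℝ (fun z => christoffel G a d m z * christoffel G m c b z -
      christoffel G a c m z * christoffel G m d b z) y := fun m =>
      ((hdΓ _ _ _).fun_mul (hdΓ _ _ _)).fun_sub ((hdΓ _ _ _).fun_mul (hdΓ _ _ _))
    have h2 : partialDeriv e (riemannUp G a b c d) y =
        partialDeriv e (partialDeriv d (christoffel G a c b)) y -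
        partialDeriv e (partialDeriv c (christoffel G a d b)) y +
        ∑ m, ((partialDeriv e (christoffel G a d m) y * christoffel G m c b y +
          christoffel G a d m y * partialDeriv e (christoffel G m c b) y) -
          (partialDeriv e (christoffel G a c m) y * christoffel G m d b y +
          christoffel G a c m y * partialDeriv e (christoffel G m d b) y)) := by
      rw [show riemannUp G a b c d = fun z => (partialDeriv d (christoffel G a c b) z -
        partialDeriv c (christoffel G a d b) z) +
        ∑ m, (christoffel G a d m z * christoffel G m c b z -
        christoffel G a c m z * christoffel G m d b z) from rfl]
      rw [partialDeriv_add ((hdD _ _ _ _).fun_sub (hdD _ _ _ _))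
        (DifferentiableAt.fun_sum fun m _ => h1 m), partialDeriv_sub (hdD _ _ _ _) (hdD _ _ _ _),
        partialDeriv_sum _ fun m _ => h1 m]
      congr 1
      refine Finset.sum_congr rfl fun m _ => ?_
      rw [partialDeriv_sub ((hdΓ _ _ _).fun_mul (hdΓ _ _ _)) ((hdΓ _ _ _).fun_mul (hdΓ _ _ _)),
        partialDeriv_mul (hdΓ _ _ _) (hdΓ _ _ _), partialDeriv_mul (hdΓ _ _ _) (hdΓ _ _ _)]
    simp [h2, D, DD, Γ, Matrix.mul_apply, Finset.sum_add_distrib]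
  have key : ∀ c d e, (Matrix.of fun a b => partialDeriv e (riemannUp G a b c d) y +
        ∑ m, christoffel G a e m y * riemannUp G m b c d y -
        ∑ m, christoffel G m e b y * riemannUp G a m c d y) =
      DD e d c - DD e c d + (D e d * Γ c + Γ d * D e c - (D e c * Γ d + Γ c * D e d)) +
        Γ e * (D d c - D c d + (Γ d * Γ c - Γ c * Γ d)) -
        (D d c - D c d + (Γ d * Γ c - Γ c * Γ d)) * Γ e := fun c d e => by
    rw [← hDR, ← hR]
    ext a b
    simp [Γ, Matrix.mul_apply, mul_comm]
  have hz := congrArg₂ (· + ·) (congrArg₂ (· + ·) (key c d e) (key d e c)) (key e c d)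
  refine (congrFun (congrFun hz a) b).trans ?_
  rw [hDD e d c, hDD e c d, hDD c d e]
  suffices h : (DD d e c - DD c e d + (D e d * Γ c + Γ d * D e c - (D e c * Γ d + Γ c * D e d)) +
        Γ e * (D d c - D c d + (Γ d * Γ c - Γ c * Γ d)) -
        (D d c - D c d + (Γ d * Γ c - Γ c * Γ d)) * Γ e) +
      (DD c e d - DD d c e + (D c e * Γ d + Γ e * D c d - (D c d * Γ e + Γ d * D c e)) +
        Γ c * (D e d - D d e + (Γ e * Γ d - Γ d * Γ e)) -
        (D e d - D d e + (Γ e * Γ d - Γ d * Γ e)) * Γ c) +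
      (DD d c e - DD d e c + (D d c * Γ e + Γ c * D d e - (D d e * Γ c + Γ e * D d c)) +
        Γ d * (D c e - D e c + (Γ c * Γ e - Γ e * Γ c)) -
        (D c e - D e c + (Γ c * Γ e - Γ e * Γ c)) * Γ d) = 0 from
    congrFun (congrFun h a) b
  noncomm_ring

/-- The second Bianchi identity `R_{ab[cd;e]} = 0`. -/
theorem covD_riemann_cyclic (hG : IsMetricOn G U) (hy : y ∈ U) (a b c d e : Fin n) :
    covD G (fun I : Fin 4 → Fin n => riemann G (I 0) (I 1) (I 2) (I 3)) ![a, b, c, d, e] y +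
      covD G (fun I : Fin 4 → Fin n => riemann G (I 0) (I 1) (I 2) (I 3)) ![a, b, d, e, c] y +
      covD G (fun I : Fin 4 → Fin n => riemann G (I 0) (I 1) (I 2) (I 3)) ![a, b, e, c, d] y =
      0 := by
  have hdR : ∀ a b c d, DifferentiableAt ℝ (riemannUp G a b c d) y := fun a b c d =>
    hG.differentiableAt_of (timesDifferentiableOn_riemannUp hG 1 a b c d) hy
  have hdg : ∀ I, DifferentiableAt ℝ (G I) y := fun I =>
    hG.differentiableAt_of (hG.timesDifferentiableOn 1 I) hy
  have key : ∀ c d e, covD G (fun I : Fin 4 → Fin n => riemann G (I 0) (I 1) (I 2) (I 3))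
      ![a, b, c, d, e] y = ∑ m, G ![a, m] y * (partialDeriv e (riemannUp G m b c d) y +
        ∑ p, christoffel G m e p y * riemannUp G p b c d y -
        ∑ p, christoffel G p e b y * riemannUp G m p c d y) -
      ∑ p, christoffel G p e c y * riemann G a b p d y -
      ∑ p, christoffel G p e d y * riemann G a b c p y := by
    intro c d e
    have hder : partialDeriv e (riemann G a b c d) y = ∑ m,
        ((∑ p, christoffel G p e a y * G ![p, m] y + ∑ p, christoffel G p e m y * G ![a, p] y) *
          riemannUp G m b c d y + G ![a, m] y * partialDeriv e (riemannUp G m b c d) y) := by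
      rw [show riemann G a b c d = fun z => ∑ m, G ![a, m] z * riemannUp G m b c d z from rfl,
        partialDeriv_sum _ fun m _ => (hdg _).fun_mul (hdR _ _ _ _)]
      refine Finset.sum_congr rfl fun m _ => ?_
      rw [partialDeriv_mul (hdg _) (hdR _ _ _ _), hG.partialDeriv_metric hy]
    have hcov : covD G (fun I : Fin 4 → Fin n => riemann G (I 0) (I 1) (I 2) (I 3))
        ![a, b, c, d, e] y = partialDeriv e (riemann G a b c d) y -
          (∑ p, christoffel G p e a y * riemann G p b c d y +
          ∑ p, christoffel G p e b y * riemann G a p c d y +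
          ∑ p, christoffel G p e c y * riemann G a b p d y +
          ∑ p, christoffel G p e d y * riemann G a b c p y) := by
      rw [covD, Fin.sum_univ_four]
      rfl
    rw [hcov, hder]
    have e1 : ∑ p, christoffel G p e a y * riemann G p b c d y =
        ∑ m, (∑ p, christoffel G p e a y * G ![p, m] y) * riemannUp G m b c d y := by
      simp only [riemann, Finset.mul_sum, Finset.sum_mul, mul_assoc]
      exact Finset.sum_comm
    have e2 : ∑ p, christoffel G p e b y * riemann G a p c d y =
        ∑ m, G ![a, m] y * ∑ p, christoffel G p e b y * riemannUp G m p c d y := by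
      simp only [riemann, Finset.mul_sum]
      rw [Finset.sum_comm]
      simp only [mul_left_comm]
    have e3 : ∑ m, (∑ p, christoffel G p e m y * G ![a, p] y) * riemannUp G m b c d y =
        ∑ m, G ![a, m] y * ∑ p, christoffel G m e p y * riemannUp G p b c d y := by
      simp only [Finset.mul_sum, Finset.sum_mul]
      rw [Finset.sum_comm]
      exact Finset.sum_congr rfl fun p _ => Finset.sum_congr rfl fun m _ => by ring
    simp only [add_mul, mul_add, mul_sub, Finset.sum_add_distrib, Finset.sum_sub_distrib]
    rw [e1, e2, e3]
    ring
  have hsum : (∑ m, G ![a, m] y * (partialDeriv e (riemannUp G m b c d) y +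
        ∑ p, christoffel G m e p y * riemannUp G p b c d y -
        ∑ p, christoffel G p e b y * riemannUp G m p c d y)) +
      (∑ m, G ![a, m] y * (partialDeriv c (riemannUp G m b d e) y +
        ∑ p, christoffel G m c p y * riemannUp G p b d e y -
        ∑ p, christoffel G p c b y * riemannUp G m p d e y)) +
      (∑ m, G ![a, m] y * (partialDeriv d (riemannUp G m b e c) y +
        ∑ p, christoffel G m d p y * riemannUp G p b e c y -
        ∑ p, christoffel G p d b y * riemannUp G m p e c y)) = 0 := by
    rw [← Finset.sum_add_distrib, ← Finset.sum_add_distrib]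
    refine Finset.sum_eq_zero fun m _ => ?_
    rw [← mul_add, ← mul_add, partialDeriv_riemannUp_cyclic hG hy, mul_zero]
  have hanti : ∀ c d, riemann G a b c d y = - riemann G a b d c y := fun c d => by
    simp only [riemann]
    rw [← Finset.sum_neg_distrib]
    exact Finset.sum_congr rfl fun m _ => by rw [riemannUp_antisymm]; ring
  have hcancel : ∀ c d e, ∑ p, christoffel G p e d y * riemann G a b c p y =
      - ∑ p, christoffel G p d e y * riemann G a b p c y := fun c d e => by
    rw [← Finset.sum_neg_distrib]
    exact Finset.sum_congr rfl fun p _ => by rw [hanti c p, hG.christoffel_symm hy p e d]; ring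
  rw [key, key, key, hcancel c d e, hcancel d e c, hcancel e c d]
  linear_combination hsum

end Bianchi

/-! ### Contractions, and curvature for vanishing Weyl tensor -/

theorem comp_vecCons {α β : Type*} {m : ℕ} (f : α → β) (x : α) (u : Fin m → α) :
    f ∘ Matrix.vecCons x u = Matrix.vecCons (f x) (f ∘ u) := by
  ext i; refine Fin.cases ?_ (fun _ => ?_) i <;> rfl

theorem comp_vecEmpty {α β : Type*} (f : α → β) : f ∘ ![] = ![] := Matrix.empty_eq _

section Contract

variable {n : ℕ} {G : Components n 2} {U : Set (Coord n)} {y : Coord n}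
  (E F : Fin n → Fin n → ℝ) (X : Fin n → ℝ) (c : ℝ)

theorem contract_add : contract G y (fun i j => E i j + F i j) =
    contract G y E + contract G y F := by
  simp [contract, mul_add, Finset.sum_add_distrib]

theorem contract_sub : contract G y (fun i j => E i j - F i j) =
    contract G y E - contract G y F := by
  simp [contract, mul_sub, Finset.sum_sub_distrib]

theorem contract_neg : contract G y (fun i j => - F i j) = - contract G y F := by
  simp [contract]

theorem contract_const_mul : contract G y (fun i j => c * F i j) = c * contract G y F := by
  simp [contract, Finset.mul_sum, mul_left_comm]

theorem contract_mul_const : contract G y (fun i j => F i j * c) = contract G y F * c := by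
  simp [contract, Finset.sum_mul, mul_assoc]

theorem contract_zero : contract G y (fun _ _ => 0) = 0 := by simp [contract]

/-- Contractions over two disjoint pairs of indices commute. -/
theorem contract_comm (F : Fin n → Fin n → Fin n → Fin n → ℝ) :
    contract G y (fun i j => contract G y fun k l => F i j k l) =
      contract G y (fun k l => contract G y fun i j => F i j k l) := by
  have h : ∀ E : Fin n → Fin n → ℝ, contract G y E =
      ∑ p : Fin n × Fin n, invMetric G y p.1 p.2 * E p.1 p.2 := fun E =>
    (Fintype.sum_prod_type' fun i j => invMetric G y i j * E i j).symm
  simp only [h, Finset.mul_sum]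
  rw [Finset.sum_comm]
  simp only [mul_left_comm]

theorem contract_swap (hG : IsMetricOn G U) (hy : y ∈ U) :
    contract G y (fun i j => F j i) = contract G y F := by
  unfold contract
  rw [Finset.sum_comm]
  exact Finset.sum_congr rfl fun i _ => Finset.sum_congr rfl fun j _ => by
    rw [hG.invMetric_symm hy]

theorem contract_metric_left_mul (hG : IsMetricOn G U) (hy : y ∈ U) (d : Fin n) :
    contract G y (fun i j => G ![i, d] y * X j) = X d := by
  have : contract G y (fun i j => G ![i, d] y * X j) =
      ∑ j, (∑ i, invMetric G y j i * G ![i, d] y) * X j := by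
    unfold contract
    rw [Finset.sum_comm]
    refine Finset.sum_congr rfl fun j _ => ?_
    rw [Finset.sum_mul]
    exact Finset.sum_congr rfl fun i _ => by rw [hG.invMetric_symm hy i j]; ring
  simp [this, hG.sum_invMetric_mul_metric hy]

theorem contract_metric_right_mul (hG : IsMetricOn G U) (hy : y ∈ U) (d : Fin n) :
    contract G y (fun i j => G ![j, d] y * X i) = X d := by
  rw [← contract_swap _ hG hy]
  exact contract_metric_left_mul X hG hy d

theorem contract_metric (hG : IsMetricOn G U) (hy : y ∈ U) :
    contract G y (fun i j => G ![i, j] y) = n := by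
  have : ∀ i, ∑ j, invMetric G y i j * G ![i, j] y = 1 := fun i => by
    have := hG.sum_invMetric_mul_metric hy i i
    simp only [if_true] at this
    rw [← this]
    exact Finset.sum_congr rfl fun j _ => by rw [hG.symm y hy]
  simp [contract, this]

end Contract

/-- The Schouten tensor `P_{ab} = (R_{ab} - R / (2(n-1)) g_{ab}) / (n-2)`; its sign is that of the
Ricci tensor. -/
def schouten {n : ℕ} (G : Components n 2) : Components n 2 := fun I y =>
  1 / ((n : ℝ) - 2) * (ricci G (I 0) (I 1) y - scalarCurv G y / (2 * ((n : ℝ) - 1)) * G I y)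

section ConformallyFlat

variable {n k : ℕ} {G : Components n 2} {U : Set (Coord n)} {y : Coord n}

theorem timesDifferentiableOn_schouten (hG : IsMetricOn G U) (r : ℕ) (I : Fin 2 → Fin n) :
    TimesDifferentiableOn r (schouten G I) U := by
  have hR : ∀ a b, TimesDifferentiableOn r (ricci G a b) U := fun a b =>
    .sum hG.isOpen _ fun m _ => timesDifferentiableOn_riemannUp hG r m a m b
  have hS : TimesDifferentiableOn r (scalarCurv G) U := .sum hG.isOpen Finset.univ fun i _ =>
    .sum hG.isOpen Finset.univ fun j _ => .mul hG.isOpen (hG.timesDifferentiableOn_invMetric r i j) (hR i j)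
  refine .const_mul hG.isOpen _ (.sub hG.isOpen (hR _ _) (.mul hG.isOpen ?_
    (hG.timesDifferentiableOn r I)))
  simp only [div_eq_mul_inv]
  exact .mul hG.isOpen hS (.const _)

/-- For vanishing Weyl tensor the curvature is the Kulkarni-Nomizu product of the metric and the
Schouten tensor. -/
theorem riemann_eq_of_weyl_eq_zero (hn : 3 ≤ n) (a b c d : Fin n) (hC : weyl G a b c d y = 0) :
    riemann G a b c d y = G ![a, c] y * schouten G ![b, d] y - G ![a, d] y * schouten G ![b, c] y
      - G ![b, c] y * schouten G ![a, d] y + G ![b, d] y * schouten G ![a, c] y := by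
  have hn' : (3 : ℝ) ≤ n := by exact_mod_cast hn
  have h1 : (n : ℝ) - 1 ≠ 0 := by linarith
  have h2 : (n : ℝ) - 2 ≠ 0 := by linarith
  rw [weyl, sub_add_eq_add_sub, sub_eq_zero] at hC
  simp only [schouten, Matrix.cons_val_zero, Matrix.cons_val_one]
  rw [eq_sub_of_add_eq hC]
  field_simp
  ring

theorem riemannUp_eq_sum (hG : IsMetricOn G U) (hy : y ∈ U) (a b c d : Fin n) :
    riemannUp G a b c d y = ∑ m, invMetric G y a m * riemann G m b c d y := by
  have : ∑ m, invMetric G y a m * riemann G m b c d y =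
      ∑ p, (∑ m, invMetric G y a m * G ![m, p] y) * riemannUp G p b c d y := by
    simp only [riemann, Finset.mul_sum, Finset.sum_mul, mul_assoc]
    exact Finset.sum_comm
  simp [this, hG.sum_invMetric_mul_metric hy]

theorem schouten_symm (hG : IsMetricOn G U) (hn : 3 ≤ n)
    (hC : ∀ a b c d, weyl G a b c d y = 0) (hy : y ∈ U) (a b : Fin n) :
    schouten G ![a, b] y = schouten G ![b, a] y := by
  -- By the first Bianchi identity, the antisymmetric part of the Ricci tensor is a multiple of
  -- `R^m_{mab}`, which vanishes since the curvature is a Kulkarni-Nomizu product.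
  have htr : ∀ c d, ∑ m, riemannUp G m m c d y = 0 := by
    intro c d
    have h1 : ∑ m, riemannUp G m m c d y = contract G y fun m b =>
        G ![b, c] y * schouten G ![m, d] y - G ![b, d] y * schouten G ![m, c] y
      - G ![m, c] y * schouten G ![b, d] y + G ![m, d] y * schouten G ![b, c] y := by
      unfold contract
      refine Finset.sum_congr rfl fun m _ => ?_
      rw [riemannUp_eq_sum hG hy]
      refine Finset.sum_congr rfl fun p _ => ?_
      rw [riemann_eq_of_weyl_eq_zero hn _ _ _ _ (hC _ _ _ _)]
    rw [h1, contract_add, contract_sub, contract_sub,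
      contract_metric_right_mul (fun i => schouten G ![i, d] y) hG hy,
      contract_metric_right_mul (fun i => schouten G ![i, c] y) hG hy,
      contract_metric_left_mul (fun i => schouten G ![i, d] y) hG hy,
      contract_metric_left_mul (fun i => schouten G ![i, c] y) hG hy]
    ring
  have hric : ricci G a b y = ricci G b a y := by
    have h2 : ricci G a b y + ∑ m, riemannUp G m m b a y - ricci G b a y = 0 := by
      unfold ricci
      rw [← Finset.sum_add_distrib, ← Finset.sum_sub_distrib]
      refine Finset.sum_eq_zero fun m _ => ?_
      rw [← riemannUp_cyclic hG hy m a m b, riemannUp_antisymm m b a m]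
      ring
    rw [htr] at h2
    linarith
  simp only [schouten, Matrix.cons_val_zero, Matrix.cons_val_one, hric, hG.symm y hy a b]

/-- The Ricci identity for vanishing Weyl tensor. -/
theorem covD_covD_sub_of_weyl_eq_zero (hG : IsMetricOn G U) (hn : 3 ≤ n)
    (hC : ∀ a b c d, weyl G a b c d y = 0) {T : Components n k}
    (hT : ∀ I, TimesDifferentiableOn 2 (T I) U) (hy : y ∈ U) (I : Fin k → Fin n) (d e : Fin n) :
    covD G (covD G T) (Fin.snoc (Fin.snoc I d) e) y -
      covD G (covD G T) (Fin.snoc (Fin.snoc I e) d) y =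
      ∑ j, (schouten G ![I j, d] y * T (Function.update I j e) y
        - schouten G ![I j, e] y * T (Function.update I j d) y
        + G ![I j, d] y *
          contract G y (fun m p => schouten G ![p, e] y * T (Function.update I j m) y)
        - G ![I j, e] y *
          contract G y (fun m p => schouten G ![p, d] y * T (Function.update I j m) y)) := by
  rw [covD_covD_sub_covD_covD hG hT hy, ← Finset.sum_neg_distrib]
  refine Finset.sum_congr rfl fun j _ => ?_
  have h1 : ∑ m, riemannUp G m (I j) d e y * T (Function.update I j m) y =
      contract G y fun m p =>
        G ![p, d] y * (T (Function.update I j m) y * schouten G ![I j, e] y)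
        - G ![p, e] y * (T (Function.update I j m) y * schouten G ![I j, d] y)
        - G ![I j, d] y * (schouten G ![p, e] y * T (Function.update I j m) y)
        + G ![I j, e] y * (schouten G ![p, d] y * T (Function.update I j m) y) := by
    unfold contract
    refine Finset.sum_congr rfl fun m _ => ?_
    rw [riemannUp_eq_sum hG hy, Finset.sum_mul]
    refine Finset.sum_congr rfl fun p _ => ?_
    rw [riemann_eq_of_weyl_eq_zero hn _ _ _ _ (hC _ _ _ _)]
    ring
  rw [h1, contract_add, contract_sub, contract_sub,
    contract_metric_right_mul (fun m => T (Function.update I j m) y * schouten G ![I j, e] y) hG hy,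
    contract_metric_right_mul (fun m => T (Function.update I j m) y * schouten G ![I j, d] y) hG hy,
    contract_const_mul, contract_const_mul]
  ring

/-- For vanishing Weyl tensor, the Cotton tensor is a trace term; it is in fact zero, but this is
not needed. The proof contracts the second Bianchi identity once. -/
theorem exists_covD_schouten_sub_eq (hG : IsMetricOn G U) (hn : 4 ≤ n)
    (hC : ∀ y ∈ U, ∀ a b c d, weyl G a b c d y = 0) (hy : y ∈ U) :
    ∃ s : Fin n → ℝ, ∀ b d e,
      covD G (schouten G) ![b, d, e] y - covD G (schouten G) ![b, e, d] y =
        G ![b, d] y * s e - G ![b, e] y * s d := by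
  set D : Fin n → Fin n → Fin n → ℝ := fun b d e =>
    covD G (schouten G) ![b, d, e] y - covD G (schouten G) ![b, e, d] y with hD
  have hn' : (4 : ℝ) ≤ n := by exact_mod_cast hn
  have hn3 : (n : ℝ) - 3 ≠ 0 := by linarith
  have hP := hasCovDOn (G := G) (timesDifferentiableOn_schouten hG 1)
  have hR : HasCovDOn G U (fun I : Fin 4 → Fin n => riemann G (I 0) (I 1) (I 2) (I 3)) _ :=
    ((((hP.metric_mul hG (k := 4) ![0, 2] ![1, 3] ![0, 2] ![1, 3, 4]).sub hG.isOpen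
      (hP.metric_mul hG ![0, 3] ![1, 2] ![0, 3] ![1, 2, 4])).sub hG.isOpen
      (hP.metric_mul hG ![1, 2] ![0, 3] ![1, 2] ![0, 3, 4])).add hG.isOpen
      (hP.metric_mul hG ![1, 3] ![0, 2] ![1, 3] ![0, 2, 4])).congr hG.isOpen fun y hy I => by
      rw [riemann_eq_of_weyl_eq_zero (by omega) _ _ _ _ (hC y hy _ _ _ _)]
      simp only [comp_vecCons, comp_vecEmpty]
  have hB : ∀ a b c d e, G ![a, c] y * D b d e + G ![a, d] y * D b e c + G ![a, e] y * D b c d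
      - G ![b, c] y * D a d e - G ![b, d] y * D a e c - G ![b, e] y * D a c d = 0 := by
    intro a b c d e
    have h := covD_riemann_cyclic hG hy a b c d e
    rw [hR.covD_eq y hy, hR.covD_eq y hy, hR.covD_eq y hy] at h
    simp only [comp_vecCons, comp_vecEmpty, Matrix.cons_val] at h
    simp only [hD]
    linear_combination h
  have hanti : ∀ b d e, D b d e = - D b e d := fun b d e => by simp only [hD]; ring
  set t : Fin n → ℝ := fun e => contract G y fun i j => D i j e with ht
  refine ⟨fun e => - (t e / ((n : ℝ) - 3)), fun b d e => ?_⟩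
  have h0 : contract G y (fun a c => G ![a, c] y * D b d e + G ![a, d] y * D b e c
      + G ![a, e] y * D b c d - G ![c, b] y * D a d e - G ![b, d] y * D a e c
      - G ![b, e] y * D a c d) = 0 := by
    rw [← contract_zero (G := G) (y := y)]
    congr 1
    funext a c
    rw [← hB a b c d e, hG.symm y hy c b]
  rw [contract_sub, contract_sub, contract_sub, contract_add, contract_add, contract_mul_const,
    contract_metric hG hy, contract_metric_left_mul (fun c => D b e c) hG hy,
    contract_metric_left_mul (fun c => D b c d) hG hy,
    contract_metric_right_mul (fun a => D a d e) hG hy,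
    contract_const_mul, contract_const_mul] at h0
  have h1 : contract G y (fun a c => D a e c) = - t e := by
    rw [ht, ← contract_neg]
    simp only [hanti _ e]
  have h2 : contract G y (fun a c => D a c d) = t d := rfl
  rw [h1, h2, hanti b e d] at h0
  change D b d e = _
  field_simp
  linear_combination h0

end ConformallyFlat

/-! ### Antisymmetrisation modulo trace terms -/

section Alternation

variable {n : ℕ}

/-- Arrays `F a b f c d e` of the components of tensors with three upper and three lower indices;
all indices are lowered, and the upper ones come first. -/
abbrev Array33 (n : ℕ) : Type := Fin n → Fin n → Fin n → Fin n → Fin n → Fin n → ℝ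

/-- Antisymmetrisation over the first three and over the last three indices. -/
def alt : Array33 n →ₗ[ℝ] Array33 n where
  toFun F a b f c d e :=
    asym3 (fun a b f => asym3 (fun c d e => F a b f c d e) c d e) a b f
  map_add' F H := by
    funext a b f c d e
    simp only [Pi.add_apply, asym3]
    ring
  map_smul' r F := by
    funext a b f c d e
    simp only [Pi.smul_apply, smul_eq_mul, asym3, RingHom.id_apply]
    ring

theorem alt_apply (F : Array33 n) (a b f c d e : Fin n) : alt F a b f c d e =
    asym3 (fun a b f => asym3 (fun c d e => F a b f c d e) c d e) a b f := rfl

variable (F : Array33 n)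

theorem alt_swap_ab : alt (fun a b f c d e => F b a f c d e) = - alt F := by
  funext a b f c d e
  simp only [alt_apply, Pi.neg_apply, asym3]
  ring

theorem alt_swap_bf : alt (fun a b f c d e => F a f b c d e) = - alt F := by
  funext a b f c d e
  simp only [alt_apply, Pi.neg_apply, asym3]
  ring

theorem alt_swap_cd : alt (fun a b f c d e => F a b f d c e) = - alt F := by
  funext a b f c d e
  simp only [alt_apply, Pi.neg_apply, asym3]
  ring

theorem alt_swap_de : alt (fun a b f c d e => F a b f c e d) = - alt F := by
  funext a b f c d e
  simp only [alt_apply, Pi.neg_apply, asym3]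
  ring

/-- The linear functional `Φ` factors through the antisymmetrisation, and it annihilates the trace
terms `g_{ac} X_{bfde}`. These functionals detect whether the antisymmetrisation of an array is a
trace term. -/
structure IsAltModTrace (g : Fin n → Fin n → ℝ) (Φ : Array33 n →ₗ[ℝ] ℝ) : Prop where
  swap_ab : ∀ F : Array33 n, Φ (fun a b f c d e => F b a f c d e) = - Φ F
  swap_bf : ∀ F : Array33 n, Φ (fun a b f c d e => F a f b c d e) = - Φ F
  swap_cd : ∀ F : Array33 n, Φ (fun a b f c d e => F a b f d c e) = - Φ F
  swap_de : ∀ F : Array33 n, Φ (fun a b f c d e => F a b f c e d) = - Φ F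
  metric_ac_mul : ∀ X : Fin n → Fin n → Fin n → Fin n → ℝ,
    Φ (fun a b f c d e => g a c * X b f d e) = 0

/-- The linear map which sends `X` to the antisymmetrisation of `g_{ac} X_{bfde}`. -/
def altMetricMul (g : Fin n → Fin n → ℝ) :
    (Fin n → Fin n → Fin n → Fin n → ℝ) →ₗ[ℝ] Array33 n where
  toFun X := alt fun a b f c d e => g a c * X b f d e
  map_add' X Y := by
    rw [← alt.map_add]
    congr 1
    funext a b f c d e
    exact mul_add _ _ _
  map_smul' r X := by
    rw [RingHom.id_apply, ← alt.map_smul]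
    congr 1
    funext a b f c d e
    exact mul_left_comm _ _ _

/-- If every functional which annihilates trace terms vanishes on `F`, then the antisymmetrisation
of `F` is a trace term: otherwise its class modulo the range of `altMetricMul g` would be detected
by a linear form. -/
theorem exists_alt_eq_metric_mul {g : Fin n → Fin n → ℝ} {F : Array33 n}
    (h : ∀ Φ, IsAltModTrace g Φ → Φ F = 0) :
    ∃ X : Fin n → Fin n → Fin n → Fin n → ℝ,
      alt F = alt fun a b f c d e => g a c * X b f d e := by
  set q := (LinearMap.range (altMetricMul g)).mkQ with hq
  have h0 : q (alt F) = 0 := by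
    rw [← Module.forall_dual_apply_eq_zero_iff ℝ]
    intro φ
    refine h (φ ∘ₗ q ∘ₗ alt) ⟨fun F => ?_, fun F => ?_, fun F => ?_, fun F => ?_, fun X => ?_⟩
    · exact (congrArg (φ ∘ₗ q) (alt_swap_ab F)).trans ((φ ∘ₗ q).map_neg _)
    · exact (congrArg (φ ∘ₗ q) (alt_swap_bf F)).trans ((φ ∘ₗ q).map_neg _)
    · exact (congrArg (φ ∘ₗ q) (alt_swap_cd F)).trans ((φ ∘ₗ q).map_neg _)
    · exact (congrArg (φ ∘ₗ q) (alt_swap_de F)).trans ((φ ∘ₗ q).map_neg _)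
    · have : q (altMetricMul g X) = 0 := (Submodule.Quotient.mk_eq_zero _).2 ⟨X, rfl⟩
      exact (congrArg φ this).trans φ.map_zero
  obtain ⟨X, hX⟩ := (Submodule.Quotient.mk_eq_zero _).1 h0
  exact ⟨X, hX.symm⟩

namespace IsAltModTrace

variable {g : Fin n → Fin n → ℝ}
  {Φ : Array33 n →ₗ[ℝ] ℝ}

theorem swap_af (hΦ : IsAltModTrace g Φ) (F : Array33 n) :
    Φ (fun a b f c d e => F f b a c d e) = - Φ F := by
  rw [hΦ.swap_ab fun a b f c d e => F f a b c d e, hΦ.swap_bf fun a b f c d e => F b a f c d e,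
    hΦ.swap_ab F, neg_neg]

theorem swap_ce (hΦ : IsAltModTrace g Φ) (F : Array33 n) :
    Φ (fun a b f c d e => F a b f e d c) = - Φ F := by
  rw [hΦ.swap_cd fun a b f c d e => F a b f e c d, hΦ.swap_de fun a b f c d e => F a b f d c e,
    hΦ.swap_cd F, neg_neg]

theorem map_eq_neg (Φ : Array33 n →ₗ[ℝ] ℝ) {F H : Array33 n}
    (h : ∀ a b f c d e, F a b f c d e = - H a b f c d e) : Φ F = - Φ H := by
  exact (congrArg Φ (by funext a b f c d e; exact h a b f c d e)).trans (Φ.map_neg H)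

theorem map_eq_map (Φ : Array33 n →ₗ[ℝ] ℝ) {F H : Array33 n}
    (h : ∀ a b f c d e, F a b f c d e = H a b f c d e) : Φ F = Φ H :=
  congrArg Φ (by funext a b f c d e; exact h a b f c d e)

theorem map_fun_add (Φ : Array33 n →ₗ[ℝ] ℝ) (F H : Array33 n) :
    Φ (fun a b f c d e => F a b f c d e + H a b f c d e) = Φ F + Φ H := Φ.map_add F H

theorem map_fun_sub (Φ : Array33 n →ₗ[ℝ] ℝ) (F H : Array33 n) :
    Φ (fun a b f c d e => F a b f c d e - H a b f c d e) = Φ F - Φ H := Φ.map_sub F H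

theorem eq_zero_of_symm_ab (hΦ : IsAltModTrace g Φ) {F : Array33 n}
    (h : ∀ a b f c d e, F b a f c d e = F a b f c d e) : Φ F = 0 :=
  self_eq_neg.1 ((map_eq_map Φ h).symm.trans (hΦ.swap_ab F))

theorem eq_zero_of_symm_af (hΦ : IsAltModTrace g Φ) {F : Array33 n}
    (h : ∀ a b f c d e, F f b a c d e = F a b f c d e) : Φ F = 0 :=
  self_eq_neg.1 ((map_eq_map Φ h).symm.trans (hΦ.swap_af F))

theorem eq_zero_of_symm_bf (hΦ : IsAltModTrace g Φ) {F : Array33 n}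
    (h : ∀ a b f c d e, F a f b c d e = F a b f c d e) : Φ F = 0 :=
  self_eq_neg.1 ((map_eq_map Φ h).symm.trans (hΦ.swap_bf F))

theorem eq_zero_of_symm_cd (hΦ : IsAltModTrace g Φ) {F : Array33 n}
    (h : ∀ a b f c d e, F a b f d c e = F a b f c d e) : Φ F = 0 :=
  self_eq_neg.1 ((map_eq_map Φ h).symm.trans (hΦ.swap_cd F))

theorem eq_zero_of_symm_ce (hΦ : IsAltModTrace g Φ) {F : Array33 n}
    (h : ∀ a b f c d e, F a b f e d c = F a b f c d e) : Φ F = 0 :=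
  self_eq_neg.1 ((map_eq_map Φ h).symm.trans (hΦ.swap_ce F))

theorem eq_zero_of_symm_de (hΦ : IsAltModTrace g Φ) {F : Array33 n}
    (h : ∀ a b f c d e, F a b f c e d = F a b f c d e) : Φ F = 0 :=
  self_eq_neg.1 ((map_eq_map Φ h).symm.trans (hΦ.swap_de F))

variable (X : Fin n → Fin n → Fin n → Fin n → ℝ)

theorem metric_ad_mul (hΦ : IsAltModTrace g Φ) : Φ (fun a b f c d e => g a d * X b f c e) = 0 := by
  rw [hΦ.swap_cd fun a b f c d e => g a c * X b f d e, hΦ.metric_ac_mul, neg_zero]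

theorem metric_ae_mul (hΦ : IsAltModTrace g Φ) : Φ (fun a b f c d e => g a e * X b f c d) = 0 := by
  rw [hΦ.swap_de fun a b f c d e => g a d * X b f c e, hΦ.metric_ad_mul, neg_zero]

theorem metric_bc_mul (hΦ : IsAltModTrace g Φ) : Φ (fun a b f c d e => g b c * X a f d e) = 0 := by
  rw [hΦ.swap_ab fun a b f c d e => g a c * X b f d e, hΦ.metric_ac_mul, neg_zero]

theorem metric_bd_mul (hΦ : IsAltModTrace g Φ) : Φ (fun a b f c d e => g b d * X a f c e) = 0 := by
  rw [hΦ.swap_ab fun a b f c d e => g a d * X b f c e, hΦ.metric_ad_mul, neg_zero]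

theorem metric_be_mul (hΦ : IsAltModTrace g Φ) : Φ (fun a b f c d e => g b e * X a f c d) = 0 := by
  rw [hΦ.swap_ab fun a b f c d e => g a e * X b f c d, hΦ.metric_ae_mul, neg_zero]

theorem metric_fc_mul (hΦ : IsAltModTrace g Φ) : Φ (fun a b f c d e => g f c * X a b d e) = 0 := by
  rw [hΦ.swap_bf fun a b f c d e => g b c * X a f d e, hΦ.metric_bc_mul, neg_zero]

theorem metric_fd_mul (hΦ : IsAltModTrace g Φ) : Φ (fun a b f c d e => g f d * X a b c e) = 0 := by
  rw [hΦ.swap_bf fun a b f c d e => g b d * X a f c e, hΦ.metric_bd_mul, neg_zero]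

theorem metric_fe_mul (hΦ : IsAltModTrace g Φ) : Φ (fun a b f c d e => g f e * X a b c d) = 0 := by
  rw [hΦ.swap_bf fun a b f c d e => g b e * X a f c d, hΦ.metric_be_mul, neg_zero]

end IsAltModTrace

end Alternation

section CommutatorIdentity

variable {n : ℕ} {g P : Fin n → Fin n → ℝ}
  {Φ : Array33 n →ₗ[ℝ] ℝ} {P' : Fin n → Fin n → Fin n → ℝ}
  {L : Fin n → Fin n → Fin n → ℝ} {L' : Fin n → Fin n → Fin n → Fin n → ℝ}
  {L₃ : Fin n → Fin n → Fin n → Fin n → Fin n → Fin n → ℝ}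

open IsAltModTrace

/-- The antisymmetrised derivative `L_{abc;def}` reduces to the derivative of the Ricci identity
for `L`. Here `L'` and `L₃` are the first and third covariant derivatives of `L`, and `P'` is that
of the Schouten tensor `P`. The terms with `P'` are trace terms since the Cotton tensor is. -/
theorem map_third_derivative (hΦ : IsAltModTrace g Φ) (hg : ∀ a b, g a b = g b a)
    (hP : ∀ a b, P a b = P b a) (hP' : ∀ a b c, P' a b c = P' b a c)
    (hL : ∀ a b c, L a b c = - L b a c) (hL' : ∀ a b c d, L' a b c d = - L' b a c d)
    {s : Fin n → ℝ} (hC : ∀ b d e, P' b d e - P' b e d = g b d * s e - g b e * s d)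
    {V₁ V₂ V₃ : Fin n → Fin n → Fin n → Fin n → ℝ}
    (hK : ∀ a b c d e f, L₃ a b c d e f - L₃ a b c e d f =
      (P' a d f * L e b c + P a d * L' e b c f - (P' a e f * L d b c + P a e * L' d b c f)
        + g a d * V₁ e b c f - g a e * V₁ d b c f)
      + (P' b d f * L a e c + P b d * L' a e c f - (P' b e f * L a d c + P b e * L' a d c f)
        + g b d * V₂ a e c f - g b e * V₂ a d c f)
      + (P' c d f * L a b e + P c d * L' a b e f - (P' c e f * L a b d + P c e * L' a b d f)
        + g c d * V₃ a b e f - g c e * V₃ a b d f)) :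
    Φ (fun a b f c d e => L₃ a b c d e f) =
      -2 * Φ (fun a b f c d e => P a e * L' d b c f) := by
  have h0 := hΦ.swap_de fun a b f c d e => L₃ a b c d e f
  have h1 := (map_fun_sub Φ (fun a b f c d e => L₃ a b c d e f)
    fun a b f c d e => L₃ a b c e d f).symm
  simp only [hK] at h1
  simp only [map_fun_add, map_fun_sub] at h1
  have z1 := hΦ.metric_ad_mul fun b f c e => V₁ e b c f
  have z2 := hΦ.metric_ae_mul fun b f c d => V₁ d b c f
  have z3 := hΦ.metric_bd_mul fun a f c e => V₂ a e c f
  have z4 := hΦ.metric_be_mul fun a f c d => V₂ a d c f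
  have z5 := hΦ.eq_zero_of_symm_cd (F := fun a b f c d e => g c d * V₃ a b e f)
    fun a b f c d e => by rw [hg]
  have z6 := hΦ.eq_zero_of_symm_ce (F := fun a b f c d e => g c e * V₃ a b d f)
    fun a b f c d e => by rw [hg]
  have z7 := hΦ.eq_zero_of_symm_cd (F := fun a b f c d e => P c d * L' a b e f)
    fun a b f c d e => by rw [hP]
  have z8 := hΦ.eq_zero_of_symm_ce (F := fun a b f c d e => P c e * L' a b d f)
    fun a b f c d e => by rw [hP]
  have z9 := hΦ.eq_zero_of_symm_cd (F := fun a b f c d e => P' c d f * L a b e)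
    fun a b f c d e => by rw [hP']
  have z10 := hΦ.eq_zero_of_symm_ce (F := fun a b f c d e => P' c e f * L a b d)
    fun a b f c d e => by rw [hP']
  have p1 := hΦ.swap_de fun a b f c d e => P' a e f * L d b c
  have p2 := hΦ.swap_de fun a b f c d e => P a e * L' d b c f
  have p5 := hΦ.swap_ab fun a b f c d e => P a d * L' b e c f
  have p6 := hΦ.swap_ab fun a b f c d e => P a e * L' b d c f
  have p8 := hΦ.swap_de fun a b f c d e => P a e * L' b d c f
  have p10 := map_eq_neg Φ (F := fun a b f c d e => P a e * L' b d c f)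
      (H := fun a b f c d e => P a e * L' d b c f) fun a b f c d e => by
        rw [hL' b d c f, mul_neg]
  -- The antisymmetric part of `P'_{aef}` in `a` and `f` is a trace term.
  have hc : Φ (fun a b f c d e => P' a e f * L d b c) = 0 := by
    have c1 := hΦ.swap_af fun a b f c d e => P' a e f * L d b c
    have c2 := map_fun_sub Φ (fun a b f c d e => P' a e f * L d b c)
      (fun a b f c d e => P' f e a * L d b c)
    have c3 := map_fun_sub Φ (fun a b f c d e => g a e * (s f * L d b c))
      (fun a b f c d e => g f e * (s a * L d b c))
    have c4 : ∀ a b f c d e, P' a e f * L d b c - P' f e a * L d b c =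
        g a e * (s f * L d b c) - g f e * (s a * L d b c) := fun a b f c d e => by
      linear_combination L d b c * (hP' a e f - hP' f e a + hC e a f
        + s f * hg e a - s a * hg e f)
    simp only [c4] at c2
    have c5 := hΦ.metric_ae_mul fun b f c d => s f * L d b c
    have c6 := hΦ.metric_fe_mul fun a b c d => s a * L d b c
    linear_combination (1 / 2) * (c3 - c2 + c5 - c6 + c1)
  have p3 := hΦ.swap_ab fun a b f c d e => P' a d f * L b e c
  have p4 := hΦ.swap_ab fun a b f c d e => P' a e f * L b d c
  have p7 := hΦ.swap_de fun a b f c d e => P' a e f * L b d c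
  have p9 := map_eq_neg Φ (F := fun a b f c d e => P' a e f * L b d c)
      (H := fun a b f c d e => P' a e f * L d b c) fun a b f c d e => by rw [hL b d c, mul_neg]
  linarith

/-- The map `Φ` precomposed with the exchange of the upper and the lower indices. -/
theorem IsAltModTrace.exchange (hΦ : IsAltModTrace g Φ) (hg : ∀ a b, g a b = g b a) :
    IsAltModTrace g (Φ ∘ₗ
      { toFun := fun F a b f c d e => F c d e a b f
        map_add' := fun _ _ => rfl
        map_smul' := fun _ _ => rfl } : Array33 n →ₗ[ℝ] ℝ) where
  swap_ab F := hΦ.swap_cd fun a b f c d e => F c d e a b f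
  swap_bf F := hΦ.swap_de fun a b f c d e => F c d e a b f
  swap_cd F := hΦ.swap_ab fun a b f c d e => F c d e a b f
  swap_de F := hΦ.swap_bf fun a b f c d e => F c d e a b f
  metric_ac_mul X := by
    refine Eq.trans (map_eq_map Φ fun a b f c d e => ?_)
      (hΦ.metric_ac_mul fun b f d e => X d e b f)
    exact congrArg (· * X d e b f) (hg c a)

/-- Up to trace terms, the antisymmetrised second derivative of a Weyl candidate with a potential
is the product of the Weyl candidate and the Schouten tensor. The arrays `L'`, `L₃` are the first
and third covariant derivatives of the potential `L`, and `W₂` is the second covariant derivative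
of `W`. -/
theorem map_second_derivative (hΦ : IsAltModTrace g Φ) (hg : ∀ a b, g a b = g b a)
    (hP : ∀ a b, P a b = P b a) (hP' : ∀ a b c, P' a b c = P' b a c)
    (hL : ∀ a b c, L a b c = - L b a c) (hL' : ∀ a b c d, L' a b c d = - L' b a c d)
    {s : Fin n → ℝ} (hC : ∀ b d e, P' b d e - P' b e d = g b d * s e - g b e * s d)
    {V₁ V₂ V₃ : Fin n → Fin n → Fin n → Fin n → ℝ}
    (hK : ∀ a b c d e f, L₃ a b c d e f - L₃ a b c e d f =
      (P' a d f * L e b c + P a d * L' e b c f - (P' a e f * L d b c + P a e * L' d b c f)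
        + g a d * V₁ e b c f - g a e * V₁ d b c f)
      + (P' b d f * L a e c + P b d * L' a e c f - (P' b e f * L a d c + P b e * L' a d c f)
        + g b d * V₂ a e c f - g b e * V₂ a d c f)
      + (P' c d f * L a b e + P c d * L' a b e f - (P' c e f * L a b d + P c e * L' a b d f)
        + g c d * V₃ a b e f - g c e * V₃ a b d f))
    {Y₁ Y₂ Y₃ Y₄ : Fin n → Fin n → Fin n → Fin n → ℝ}
    (hK' : ∀ a b c d e f, L₃ a b c d e f - L₃ a b c d f e =
      (P a e * L' f b c d - P a f * L' e b c d + g a e * Y₁ f b c d - g a f * Y₁ e b c d)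
      + (P b e * L' a f c d - P b f * L' a e c d + g b e * Y₂ a f c d - g b f * Y₂ a e c d)
      + (P c e * L' a b f d - P c f * L' a b e d + g c e * Y₃ a b f d - g c f * Y₃ a b e d)
      + (P d e * L' a b c f - P d f * L' a b c e + g d e * Y₄ a b c f - g d f * Y₄ a b c e))
    {W : Fin n → Fin n → Fin n → Fin n → ℝ} {S : Fin n → Fin n → ℝ}
    (hW : ∀ a b c d, W a b c d = L' a b c d - L' a b d c + L' c d a b - L' c d b a
      + g a c * S b d - g a d * S b c - g b c * S a d + g b d * S a c)
    {W₂ : Fin n → Fin n → Fin n → Fin n → Fin n → Fin n → ℝ}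
    {S₂ : Fin n → Fin n → Fin n → Fin n → ℝ}
    (hW₂ : ∀ a b c d e f, W₂ a b c d e f =
      L₃ a b c d e f - L₃ a b d c e f + L₃ c d a b e f - L₃ c d b a e f
      + g a c * S₂ b d e f - g a d * S₂ b c e f - g b c * S₂ a d e f + g b d * S₂ a c e f) :
    Φ (fun a b f c d e => W₂ a b c d e f) + 2 * Φ (fun a b f c d e => P f e * W a c d b) =
      0 := by
  have hA1 := map_third_derivative hΦ hg hP hP' hL hL' hC hK
  -- The same for the part with upper and lower indices exchanged, where the last derivative
  -- carries the index `e`.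
  have hA2 : Φ (fun a b f c d e => L₃ c d a b f e) =
      -2 * Φ (fun a b f c d e => P c f * L' b d a e) :=
    map_third_derivative (hΦ.exchange hg) hg hP hP' hL hL' hC hK
  have hA3 := (map_fun_sub Φ (fun a b f c d e => L₃ c d a b e f)
    fun a b f c d e => L₃ c d a b f e).symm
  simp only [hK', map_fun_add, map_fun_sub] at hA3
  have hV : Φ (fun a b f c d e => W₂ a b c d e f) = Φ (fun a b f c d e => W₂ a b c d e f) := rfl
  conv_rhs at hV => simp only [hW₂, map_fun_add, map_fun_sub]
  have hWP : Φ (fun a b f c d e => P f e * W a c d b) = Φ (fun a b f c d e => P f e * W a c d b) :=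
    rfl
  have hWP' : ∀ a b f c d e, P f e * W a c d b =
      P f e * L' a c d b - P f e * L' a c b d + P f e * L' d b a c - P f e * L' d b c a
      + g a d * (S c b * P f e) - g a b * (S c d * P f e) - g c d * (S a b * P f e)
      + g b c * (S a d * P f e) := fun a b f c d e => by
    rw [hW, hg c b]
    ring
  conv_rhs at hWP => simp only [hWP', map_fun_add, map_fun_sub]
  have v1 := hΦ.swap_ab fun a b f c d e => L₃ c d a b e f
  have v2 := hΦ.swap_cd fun a b f c d e => L₃ a b c d e f
  have v3 := hΦ.metric_ac_mul fun b f d e => S₂ b d e f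
  have v4 := hΦ.metric_ad_mul fun b f c e => S₂ b c e f
  have v5 := hΦ.metric_bc_mul fun a f d e => S₂ a d e f
  have v6 := hΦ.metric_bd_mul fun a f c e => S₂ a c e f
  -- Exchange `c` with `e` and `a` with `f`.
  have swapP : ∀ Z : Fin n → Fin n → Fin n → Fin n → ℝ,
      Φ (fun a b f c d e => P c f * Z a b d e) = Φ (fun a b f c d e => P a e * Z f b d c) := by
    intro Z
    have h1 := hΦ.swap_ce fun a b f c d e => P e f * Z a b d c
    have h2 := hΦ.swap_af fun a b f c d e => P e a * Z f b d c
    have h3 := map_eq_map Φ (F := fun a b f c d e => P e a * Z f b d c)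
      (H := fun a b f c d e => P a e * Z f b d c) fun a b f c d e => by rw [hP]
    linarith
  have n1 := swapP fun a b d e => L' b d a e
  have n2 := hΦ.swap_bf fun a b f c d e => P a e * L' f d b c
  have n3 := hΦ.swap_cd fun a b f c d e => P a e * L' f c b d
  -- The terms of the Ricci identity for the derivative of `L`.
  have c1 := swapP fun a b d e => L' e d a b
  have c2 := hΦ.swap_cd fun a b f c d e => P c f * L' d e a b
  have c3 := swapP fun a b d e => L' d e a b
  have c4 := hΦ.swap_bf fun a b f c d e => P a e * L' c d b f
  have c5 := hΦ.swap_ab fun a b f c d e => P a e * L' c d b f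
  have c6 := hΦ.swap_cd fun a b f c d e => P a e * L' c d f b
  have z_ce0 := hΦ.eq_zero_of_symm_ce (F := fun a b f c d e => P c e * L' f d a b)
    fun a b f c d e => by rw [hP]
  have z_af0 := hΦ.eq_zero_of_symm_af (F := fun a b f c d e => P a f * L' c d e b)
    fun a b f c d e => by rw [hP]
  have z_de0 := hΦ.eq_zero_of_symm_de (F := fun a b f c d e => P d e * L' c f a b)
    fun a b f c d e => by rw [hP]
  have z_bf0 := hΦ.eq_zero_of_symm_bf (F := fun a b f c d e => P b f * L' c d a e)
    fun a b f c d e => by rw [hP]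
  have z_ce1 := hΦ.eq_zero_of_symm_ce (F := fun a b f c d e => g c e * Y₁ f d a b)
    fun a b f c d e => by rw [hg]
  have z_af1 := hΦ.eq_zero_of_symm_af (F := fun a b f c d e => g a f * Y₃ c d e b)
    fun a b f c d e => by rw [hg]
  have z_de1 := hΦ.eq_zero_of_symm_de (F := fun a b f c d e => g d e * Y₂ c f a b)
    fun a b f c d e => by rw [hg]
  have z_bf1 := hΦ.eq_zero_of_symm_bf (F := fun a b f c d e => g b f * Y₄ c d a e)
    fun a b f c d e => by rw [hg]
  have y1 := hΦ.metric_ae_mul fun b f c d => Y₃ c d f b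
  have y2 := hΦ.metric_be_mul fun a f c d => Y₄ c d a f
  have y3 := (map_eq_map Φ (F := fun a b f c d e => g c f * Y₁ e d a b)
    (H := fun a b f c d e => g f c * Y₁ e d a b) fun a b f c d e => by rw [hg]).trans
      (hΦ.metric_fc_mul fun a b d e => Y₁ e d a b)
  have y4 := (map_eq_map Φ (F := fun a b f c d e => g d f * Y₂ c e a b)
    (H := fun a b f c d e => g f d * Y₂ c e a b) fun a b f c d e => by rw [hg]).trans
      (hΦ.metric_fd_mul fun a b c e => Y₂ c e a b)
  -- Exchanging the last two derivatives costs nothing: each term of the commutator is a trace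
  -- term, or contains `P` or `g` with two antisymmetrised indices, or cancels against another.
  have hcomm : Φ (fun a b f c d e => L₃ c d a b e f) = Φ (fun a b f c d e => L₃ c d a b f e) := by
    linarith
  -- The terms of the product of `P` and `W`.
  have w1 := hΦ.swap_af fun a b f c d e => P a e * L' f c d b
  have w2 := hΦ.swap_cd fun a b f c d e => P a e * L' f d c b
  have w3 := hΦ.swap_bf fun a b f c d e => P a e * L' b d c f
  have w4 := map_eq_neg Φ (F := fun a b f c d e => P a e * L' b d c f)
      (H := fun a b f c d e => P a e * L' d b c f) fun a b f c d e => by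
        rw [hL' b d c f, mul_neg]
  have w5 := hΦ.swap_af fun a b f c d e => P a e * L' f c b d
  have w6 := hΦ.swap_af fun a b f c d e => P a e * L' d b f c
  have w7 := hΦ.swap_bf fun a b f c d e => P a e * L' d f b c
  have w8 := hΦ.swap_cd fun a b f c d e => P a e * L' c f b d
  have w9 := map_eq_neg Φ (F := fun a b f c d e => P a e * L' c f b d)
      (H := fun a b f c d e => P a e * L' f c b d) fun a b f c d e => by
        rw [hL' c f b d, mul_neg]
  have w10 := hΦ.swap_af fun a b f c d e => P a e * L' d b c f
  have w11 := hΦ.metric_ad_mul fun b f c e => S c b * P f e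
  have w12 := hΦ.eq_zero_of_symm_ab (F := fun a b f c d e => g a b * (S c d * P f e))
    fun a b f c d e => by rw [hg]
  have w13 := hΦ.eq_zero_of_symm_cd (F := fun a b f c d e => g c d * (S a b * P f e))
    fun a b f c d e => by rw [hg]
  have w14 := hΦ.metric_bc_mul fun a f d e => S a d * P f e
  have hprod : Φ (fun a b f c d e => P f e * W a c d b) =
      2 * Φ (fun a b f c d e => P a e * L' d b c f) +
        2 * Φ (fun a b f c d e => P a e * L' f c b d) := by
    linarith
  linarith

end CommutatorIdentity

/-! ### The trace-free part of an antisymmetrised array -/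

section TraceDecomposition

variable {n : ℕ}

theorem asym3_of_antisymm_left {F : Fin n → Fin n → Fin n → ℝ} (h : ∀ a b c, F b a c = - F a b c)
    (a b c : Fin n) : asym3 F a b c = (F a b c + F b c a + F c a b) / 3 := by
  rw [asym3, h a b c, h c a b, h b c a]
  ring

theorem asym3_of_antisymm_right {F : Fin n → Fin n → Fin n → ℝ} (h : ∀ a b c, F a c b = - F a b c)
    (a b c : Fin n) : asym3 F a b c = (F a b c + F b c a + F c a b) / 3 := by
  rw [asym3, h a b c, h b c a, h c a b]
  ring

/-- The antisymmetrisation of an array which is antisymmetric in `a, b` and in `c, d`. -/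
theorem alt_of_antisymm_left {F : Array33 n} (h₁ : ∀ a b f c d e, F b a f c d e = - F a b f c d e)
    (h₂ : ∀ a b f c d e, F a b f d c e = - F a b f c d e) (a b f c d e : Fin n) :
    9 * alt F a b f c d e =
      F a b f c d e + F a b f d e c + F a b f e c d
      + F b f a c d e + F b f a d e c + F b f a e c d
      + F f a b c d e + F f a b d e c + F f a b e c d := by
  have h : ∀ a b f, asym3 (fun c d e => F a b f c d e) c d e =
      (F a b f c d e + F a b f d e c + F a b f e c d) / 3 := fun a b f =>
    asym3_of_antisymm_left (h₂ a b f) c d e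
  rw [alt_apply, asym3_of_antisymm_left fun a b f => by
    rw [h, h, h₁ a b f c d e, h₁ a b f d e c, h₁ a b f e c d]; ring]
  simp only [h]
  ring

/-- The antisymmetrisation of an array which is antisymmetric in `b, f` and in `d, e`. -/
theorem alt_of_antisymm_right {F : Array33 n} (h₁ : ∀ a b f c d e, F a f b c d e = - F a b f c d e)
    (h₂ : ∀ a b f c d e, F a b f c e d = - F a b f c d e) (a b f c d e : Fin n) :
    9 * alt F a b f c d e =
      F a b f c d e + F a b f d e c + F a b f e c d
      + F b f a c d e + F b f a d e c + F b f a e c d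
      + F f a b c d e + F f a b d e c + F f a b e c d := by
  have h : ∀ a b f, asym3 (fun c d e => F a b f c d e) c d e =
      (F a b f c d e + F a b f d e c + F a b f e c d) / 3 := fun a b f =>
    asym3_of_antisymm_right (h₂ a b f) c d e
  rw [alt_apply, asym3_of_antisymm_right fun a b f => by
    rw [h, h, h₁ a b f c d e, h₁ a b f d e c, h₁ a b f e c d]; ring]
  simp only [h]
  ring

variable {G : Components n 2} {U : Set (Coord n)} {y : Coord n}

/-- If the antisymmetrisation `α` of `g_{ac} X_{bfde}` has a vanishing triple trace, then `X` is
determined by the trace `T` of `9 α` and by the trace of `T`. -/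
theorem eq_of_alt_metric_mul (hG : IsMetricOn G U) (hy : y ∈ U) (hn : 5 ≤ n)
    {X : Fin n → Fin n → Fin n → Fin n → ℝ} (hX₁ : ∀ b f d e, X f b d e = - X b f d e)
    (hX₂ : ∀ b f d e, X b f e d = - X b f d e)
    {T : Fin n → Fin n → Fin n → Fin n → ℝ}
    (hT : ∀ b f d e, T b f d e = contract G y fun i j =>
      9 * alt (fun a b f c d e => G ![a, c] y * X b f d e) i b f j d e)
    {Z : Fin n → Fin n → ℝ} (hZ : ∀ f e, Z f e = contract G y fun i j => T i f j e)
    (hZ0 : contract G y Z = 0) (b f d e : Fin n) :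
    X b f d e = 1 / ((n : ℝ) - 4) * (T b f d e - 1 / (2 * ((n : ℝ) - 3)) *
      (G ![b, d] y * Z f e - G ![b, e] y * Z f d - G ![f, d] y * Z b e + G ![f, e] y * Z b d)) := by
  have hn' : (5 : ℝ) ≤ n := by exact_mod_cast hn
  have h4 : (n : ℝ) - 4 ≠ 0 := by linarith
  have h3 : (n : ℝ) - 3 ≠ 0 := by linarith
  set x : Fin n → Fin n → ℝ := fun f e => contract G y fun i j => X i f j e with hx
  set t : ℝ := contract G y x with ht
  have hT' : ∀ b f d e, T b f d e = ((n : ℝ) - 4) * X b f d e + G ![b, d] y * x f e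
      - G ![b, e] y * x f d - G ![f, d] y * x b e + G ![f, e] y * x b d := by
    intro b f d e
    have hα : ∀ i j, 9 * alt (fun a b f c d e => G ![a, c] y * X b f d e) i b f j d e =
        G ![i, j] y * X b f d e - G ![i, d] y * X b f j e - G ![i, e] y * X b f d j
        - G ![j, b] y * X i f d e - G ![j, f] y * X b i d e
        + G ![b, d] y * X i f j e - G ![b, e] y * X i f j d
        - G ![f, d] y * X i b j e + G ![f, e] y * X i b j d := fun i j => by
      rw [alt_of_antisymm_right (fun a b f c d e => by rw [hX₁ b f]; ring)
        (fun a b f c d e => by rw [hX₂ b f]; ring), hX₂ b f j e, hX₁ i f, hX₁ i f, hX₁ i f,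
        hX₂ i f j e, hX₂ i b j e, hX₁ b i, hX₂ b f d j, hG.symm y hy b j, hG.symm y hy f j]
      ring
    rw [hT]
    simp only [hα]
    rw [contract_add, contract_sub, contract_sub, contract_add, contract_sub, contract_sub,
      contract_sub, contract_sub, contract_mul_const, contract_metric hG hy,
      contract_metric_left_mul (fun j => X b f j e) hG hy,
      contract_metric_left_mul (fun j => X b f d j) hG hy,
      contract_metric_right_mul (fun i => X i f d e) hG hy,
      contract_metric_right_mul (fun i => X b i d e) hG hy,
      contract_const_mul, contract_const_mul, contract_const_mul, contract_const_mul]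
    ring
  have hZ' : ∀ f e, Z f e = (2 * (n : ℝ) - 6) * x f e + G ![f, e] y * t := by
    intro f e
    rw [hZ]
    simp only [hT']
    have e1 : contract G y (fun i j => G ![i, e] y * x f j) = x f e :=
      contract_metric_left_mul _ hG hy e
    have e2 : contract G y (fun i j => G ![f, j] y * x i e) = x f e := by
      simp only [hG.symm y hy f]
      exact contract_metric_right_mul (fun i => x i e) hG hy f
    have e3 : contract G y (fun i j => x i j) = t := rfl
    have e4 : contract G y (fun i j => X i f j e) = x f e := rfl
    rw [contract_add, contract_sub, contract_sub, contract_add, contract_const_mul,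
      contract_mul_const, contract_metric hG hy, contract_const_mul, e1, e2, e3, e4]
    ring
  -- The trace of `Z` is `3 (n - 2) t`.
  have ht0 : t = 0 := by
    have h0 : contract G y (fun i j => (2 * (n : ℝ) - 6) * x i j + G ![i, j] y * t) = 0 := by
      rw [← hZ0]
      congr 1
      funext i j
      exact (hZ' i j).symm
    have e3 : contract G y (fun i j => x i j) = t := rfl
    rw [contract_add, contract_const_mul, contract_mul_const, contract_metric hG hy, e3,
      ← add_mul] at h0
    refine (mul_eq_zero.1 h0).resolve_left ?_
    linarith
  rw [hT', hZ', hZ', hZ', hZ', ht0]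
  field_simp
  ring

/-- Under the antisymmetrisation, the explicit antisymmetrisations of the traces `A`, `B`, `C` and
`Z` turn into numerical factors. -/
theorem alt_metric_mul_trace_terms (g Z : Fin n → Fin n → ℝ)
    (A B C : Fin n → Fin n → Fin n → Fin n → ℝ) (p r : ℝ) :
    alt (fun a b f c d e => g a c * (p * (A b f d e + (B b f d e - B f b d e)
        + (C b f d e - C b f e d)
        - r * (g b d * Z f e - g b e * Z f d - g f d * Z b e + g f e * Z b d)))) =
      alt fun a b f c d e => p * g a c * A b f d e + 2 * p * g a c * B b f d e
        + 2 * p * g a c * C b f d e - 4 * p * r * g a c * g b d * Z f e := by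
  funext a b f c d e
  simp only [alt_apply, asym3]
  ring

/-- The trace-free part of the antisymmetrisation of an array `Q_{abcdef}` with the symmetries of
a second derivative of a Weyl candidate: if the antisymmetrisation is a trace term, it is the one
given by its traces. -/
theorem alt_eq_of_alt_eq_metric_mul (hG : IsMetricOn G U) (hy : y ∈ U) (hn : 5 ≤ n)
    {Q : Fin n → Fin n → Fin n → Fin n → Fin n → Fin n → ℝ}
    (hQ₁ : ∀ a b c d e f, Q b a c d e f = - Q a b c d e f)
    (hQ₂ : ∀ a b c d e f, Q a b d c e f = - Q a b c d e f)
    (hQ₀ : ∀ b d e f, contract G y (fun i j => Q i b j d e f) = 0)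
    {X : Fin n → Fin n → Fin n → Fin n → ℝ}
    (hX : alt (fun a b f c d e => Q a b c d e f) =
      alt fun a b f c d e => G ![a, c] y * X b f d e) :
    alt (fun a b f c d e => Q a b c d e f) = alt fun a b f c d e =>
      1 / ((n : ℝ) - 4) * G ![a, c] y * contract G y (fun i j => Q b f d e i j)
      + 2 / ((n : ℝ) - 4) * G ![a, c] y * contract G y (fun i j => Q i b d e j f)
      + 2 / ((n : ℝ) - 4) * G ![a, c] y * contract G y (fun i j => Q b f i d e j)
      + 4 / (((n : ℝ) - 3) * ((n : ℝ) - 4)) * G ![a, c] y * G ![b, d] y *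
        contract G y (fun i k => contract G y fun j l => Q f i e j k l) := by
  have hn' : (5 : ℝ) ≤ n := by exact_mod_cast hn
  have h4 : (n : ℝ) - 4 ≠ 0 := by linarith
  have h3 : (n : ℝ) - 3 ≠ 0 := by linarith
  -- Antisymmetrise `X`.
  set Y : Fin n → Fin n → Fin n → Fin n → ℝ := fun b f d e =>
    (X b f d e - X f b d e - X b f e d + X f b e d) / 4 with hY
  have hXY : alt (fun a b f c d e => G ![a, c] y * X b f d e) =
      alt fun a b f c d e => G ![a, c] y * Y b f d e := by
    funext a b f c d e
    simp only [alt_apply, asym3, hY]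
    ring
  rw [hXY] at hX
  set A : Fin n → Fin n → Fin n → Fin n → ℝ := fun b f d e =>
    contract G y (fun i j => Q b f d e i j) with hA
  set B : Fin n → Fin n → Fin n → Fin n → ℝ := fun b f d e =>
    contract G y (fun i j => Q i b d e j f) with hB
  set C : Fin n → Fin n → Fin n → Fin n → ℝ := fun b f d e =>
    contract G y (fun i j => Q b f i d e j) with hC
  set Z : Fin n → Fin n → ℝ := fun f e =>
    contract G y (fun i k => contract G y fun j l => Q f i e j k l) with hZ
  set T : Fin n → Fin n → Fin n → Fin n → ℝ := fun b f d e =>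
    A b f d e + (B b f d e - B f b d e) + (C b f d e - C b f e d) with hTdef
  have hT : ∀ b f d e, T b f d e = contract G y fun i j =>
      9 * alt (fun a b f c d e => G ![a, c] y * Y b f d e) i b f j d e := by
    intro b f d e
    rw [← hX]
    have hα : ∀ i j, 9 * alt (fun a b f c d e => Q a b c d e f) i b f j d e =
        Q b f d e j i + Q i b d e j f - Q i f d e j b + Q b f j d e i - Q b f j e d i
        + Q i b j d e f - Q i b j e d f - Q i f j d e b + Q i f j e d b := fun i j => by
      rw [alt_of_antisymm_left (fun a b f c d e => hQ₁ a b c d e f)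
        (fun a b f c d e => hQ₂ a b c d e f), hQ₂ i b j e, hQ₂ b f j e, hQ₁ i f j d, hQ₁ i f d e,
        hQ₁ i f e j, hQ₂ i f j e]
      ring
    have eA : contract G y (fun i j => Q b f d e j i) = A b f d e :=
      contract_swap (fun i j => Q b f d e i j) hG hy
    have eC : ∀ d e, contract G y (fun i j => Q b f j d e i) = C b f d e := fun d e =>
      contract_swap (fun i j => Q b f i d e j) hG hy
    simp only [hα]
    rw [contract_add, contract_sub, contract_sub, contract_add, contract_sub, contract_add,
      contract_sub, contract_add, eA, eC, eC, hQ₀, hQ₀, hQ₀, hQ₀]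
    simp only [hTdef, hB]
    ring
  -- The double trace: of the five terms of `T`, two contribute, each with `- Z`.
  have hTZ : ∀ f e, -2 * Z f e = contract G y fun i j => T i f j e := by
    intro f e
    have e1 : contract G y (fun i j => A i f j e) = 0 := by
      simp only [hA]
      rw [contract_comm]
      simp only [hQ₀, contract_zero]
    have e2 : contract G y (fun i j => B i f j e) = 0 := by
      simp only [hB]
      rw [contract_comm]
      have h : ∀ k l, contract G y (fun i j => Q k i j e l f) = 0 := fun k l => by
        rw [← neg_zero, ← hQ₀ k e l f, ← contract_neg]
        congr 1
        funext i j
        exact hQ₁ i k j e l f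
      simp only [h, contract_zero]
    have e3 : contract G y (fun i j => B f i j e) = Z f e := by
      simp only [hB, hZ]
      rw [contract_comm]
      congr 1
      funext k l
      rw [← contract_swap _ hG hy]
      congr 1
      funext i j
      rw [hQ₁ f k, hQ₂ f k e i, neg_neg]
    have e4 : contract G y (fun i j => C i f j e) = 0 := by
      simp only [hC]
      rw [contract_comm]
      have h : ∀ k l, contract G y (fun i j => Q i f k j e l) = 0 := fun k l => by
        rw [← neg_zero, ← hQ₀ f k e l, ← contract_neg]
        congr 1
        funext i j
        exact hQ₂ i f j k e l
      simp only [h, contract_zero]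
    have e5 : contract G y (fun i j => C i f e j) = Z f e := by
      simp only [hC, hZ]
      congr 1
      funext i j
      congr 1
      funext k l
      rw [hQ₁ f i, hQ₂ f i e k, neg_neg]
    simp only [hTdef]
    rw [contract_add, contract_add, contract_sub, contract_sub, e1, e2, e3, e4, e5]
    ring
  have hZ0 : contract G y (fun f e => -2 * Z f e) = 0 := by
    rw [contract_const_mul]
    simp only [hZ]
    rw [contract_comm]
    have : ∀ i k, contract G y (fun f e => contract G y fun j l => Q f i e j k l) = 0 :=
      fun i k => by
        rw [contract_comm]
        simp only [hQ₀, contract_zero]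
    simp only [this, contract_zero, mul_zero]
  have hYT := eq_of_alt_metric_mul hG hy hn (fun b f d e => by simp only [hY]; ring)
    (fun b f d e => by simp only [hY]; ring) hT hTZ hZ0
  have hfin := alt_metric_mul_trace_terms (fun a b => G ![a, b] y) (fun f e => -2 * Z f e) A B C
    (1 / ((n : ℝ) - 4)) (1 / (2 * ((n : ℝ) - 3)))
  refine hX.trans (Eq.trans (congrArg alt ?_) (hfin.trans (congrArg alt ?_)))
  · funext a b f c d e
    rw [hYT]
  · funext a b f c d e
    field_simp
    ring

end TraceDecomposition

/-! ### Elimination of the trace terms from the second derivative -/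

section SecondOrderCondition

variable {n : ℕ} {G : Components n 2} {U : Set (Coord n)} {y : Coord n}

/-- The trace-free Ricci tensor is `n - 2` times the Schouten tensor, up to a multiple of the
metric. -/
theorem tfRicci_eq (hn : 3 ≤ n) (y : Coord n) :
    ∃ κ : ℝ, ∀ a b, tfRicci G a b y = ((n : ℝ) - 2) * schouten G ![a, b] y + κ * G ![a, b] y := by
  have hn' : (3 : ℝ) ≤ n := by exact_mod_cast hn
  have h1 : (n : ℝ) - 2 ≠ 0 := by linarith
  refine ⟨scalarCurv G y / (2 * ((n : ℝ) - 1)) - scalarCurv G y / n, fun a b => ?_⟩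
  simp only [tfRicci, schouten, Matrix.cons_val_zero, Matrix.cons_val_one]
  field_simp
  ring

/-- The trace-free Ricci tensor has trace zero. -/
theorem contract_tfRicci (hG : IsMetricOn G U) (hy : y ∈ U) (hn : n ≠ 0) :
    contract G y (fun i j => tfRicci G i j y) = 0 := by
  have hn' : (n : ℝ) ≠ 0 := by exact_mod_cast hn
  have h : contract G y (fun i j => ricci G i j y) = scalarCurv G y := rfl
  simp only [tfRicci]
  rw [contract_sub, contract_const_mul, contract_metric hG hy, h]
  field_simp
  ring

/-- The rearrangement of the curvature terms of the second order condition, where `H`, `K`, `J`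
stand for `W_{acdb}`, `W_b^i_{fd} R_{ei}` and `W_{bde}^i R_{fi}`. -/
theorem alt_curvature_terms (g R : Fin n → Fin n → ℝ)
    (H K J : Fin n → Fin n → Fin n → Fin n → ℝ) (p q : ℝ) :
    alt (fun a b f c d e => -q * (H a c d b - H a d c b) * R f e
        - 2 * p * q * g a c * (J b f d e - J b f e d)
        - 2 * p * q * g a c * (K b f d e - K f b d e)) =
      alt fun a b f c d e => - 2 * q * H a c d b * R f e - 4 * p * q * g a c * K b f d e
        - 4 * p * q * g a c * J b f d e := by
  funext a b f c d e
  simp only [alt_apply, asym3]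
  ring

/-- The second order condition at a point follows if, up to trace terms, the antisymmetrised second
derivative of `W` is the product of `W` and the Schouten tensor. -/
theorem secondOrderConditionAt_of_altModTrace (hG : IsMetricOn G U) (hy : y ∈ U) (hn : 5 ≤ n)
    (hP : ∀ a b, schouten G ![a, b] y = schouten G ![b, a] y) {W : Components n 4}
    (hW₁ : ∀ a b c d, W ![b, a, c, d] y = - W ![a, b, c, d] y)
    (hW₂ : ∀ a b c d, W ![a, b, d, c] y = - W ![a, b, c, d] y)
    (hW₃ : ∀ a b c d, W ![c, d, a, b] y = W ![a, b, c, d] y)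
    (hW₄ : ∀ a b c d, W ![a, b, c, d] y + W ![a, c, d, b] y + W ![a, d, b, c] y = 0)
    (hW₀ : ∀ b d, contract G y (fun i j => W ![i, b, j, d] y) = 0)
    (hD₁ : ∀ a b c d e f, covD G (covD G W) ![b, a, c, d, e, f] y =
      - covD G (covD G W) ![a, b, c, d, e, f] y)
    (hD₂ : ∀ a b c d e f, covD G (covD G W) ![a, b, d, c, e, f] y =
      - covD G (covD G W) ![a, b, c, d, e, f] y)
    (hD₀ : ∀ b d e f, contract G y (fun i j => covD G (covD G W) ![i, b, j, d, e, f] y) = 0)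
    (h : ∀ Φ : Array33 n →ₗ[ℝ] ℝ, IsAltModTrace (fun a b => G ![a, b] y) Φ →
      Φ (fun a b f c d e => covD G (covD G W) ![a, b, c, d, e, f] y) +
        2 * Φ (fun a b f c d e => schouten G ![f, e] y * W ![a, c, d, b] y) = 0) :
    SecondOrderConditionAt G W y := by
  have hn' : (5 : ℝ) ≤ n := by exact_mod_cast hn
  have h2 : (n : ℝ) - 2 ≠ 0 := by linarith
  have h3 : (n : ℝ) - 3 ≠ 0 := by linarith
  have h4 : (n : ℝ) - 4 ≠ 0 := by linarith
  have hg := hG.symm y hy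
  obtain ⟨κ, hκ⟩ := tfRicci_eq (G := G) (by omega : 3 ≤ n) y
  set g : Fin n → Fin n → ℝ := fun a b => G ![a, b] y with hgdef
  set P : Fin n → Fin n → ℝ := fun a b => schouten G ![a, b] y with hPdef
  set R : Fin n → Fin n → ℝ := fun a b => tfRicci G a b y with hRdef
  set w : Fin n → Fin n → Fin n → Fin n → ℝ := fun a b c d => W ![a, b, c, d] y with hw
  set D : Fin n → Fin n → Fin n → Fin n → Fin n → Fin n → ℝ := fun a b c d e f =>
    covD G (covD G W) ![a, b, c, d, e, f] y with hD
  have hR : ∀ a b, R a b = R b a := fun a b => by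
    simp only [hRdef, hκ, hP a b, hg a b]
  have hwcyc : ∀ a b c d, w a b c d = - (w a c d b - w a d c b) := fun a b c d => by
    have e1 := hW₄ a b c d
    have e2 := hW₂ a d c b
    simp only [hw]
    linarith
  -- By the cyclic identity, `W_{acdb}` may be replaced by `- W_{abcd} / 2`, so that the whole is the
  -- antisymmetrisation of an array with the symmetries of the second derivative.
  set Q : Fin n → Fin n → Fin n → Fin n → Fin n → Fin n → ℝ := fun a b c d e f =>
    D a b c d e f - 1 / ((n : ℝ) - 2) * (w a b c d * R e f) with hQ
  obtain ⟨X, hX⟩ : ∃ X : Fin n → Fin n → Fin n → Fin n → ℝ,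
      alt (fun a b f c d e => Q a b c d e f) = alt fun a b f c d e => g a c * X b f d e := by
    refine exists_alt_eq_metric_mul fun Φ hΦ => ?_
    have e0 := IsAltModTrace.map_fun_sub Φ (fun a b f c d e => D a b c d e f)
      (fun a b f c d e => 1 / ((n : ℝ) - 2) * (w a b c d * R e f))
    have e1 : ∀ a b f c d e : Fin n, 1 / ((n : ℝ) - 2) * (w a b c d * R e f) =
        P f e * w a d c b - P f e * w a c d b + g f e * (κ / ((n : ℝ) - 2) * w a b c d) :=
      fun a b f c d e => by
        have := hwcyc a b c d
        rw [hR e f]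
        simp only [hRdef, hκ, hPdef, hgdef]
        field_simp
        linear_combination ((n : ℝ) - 2) * P f e * this
    simp only [e1] at e0
    have e2 := IsAltModTrace.map_fun_add Φ (fun a b f c d e => P f e * w a d c b - P f e * w a c d b)
      (fun a b f c d e => g f e * (κ / ((n : ℝ) - 2) * w a b c d))
    have e3 := IsAltModTrace.map_fun_sub Φ (fun a b f c d e => P f e * w a d c b)
      (fun a b f c d e => P f e * w a c d b)
    have e4 := hΦ.swap_cd fun a b f c d e => P f e * w a c d b
    have e5 := hΦ.metric_fe_mul fun a b c d => κ / ((n : ℝ) - 2) * w a b c d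
    have e6 := h Φ hΦ
    have e7 : Φ (fun a b f c d e => Q a b c d e f) =
      Φ (fun a b f c d e => D a b c d e f - (P f e * w a d c b - P f e * w a c d b +
        g f e * (κ / ((n : ℝ) - 2) * w a b c d))) := by
      simp only [hQ, e1]
    simp only [hPdef, hw, hD] at *
    linarith
  have hQ₀ : ∀ b d e f, contract G y (fun i j => Q i b j d e f) = 0 := fun b d e f => by
    simp only [hQ]
    rw [contract_sub, contract_const_mul, contract_mul_const]
    simp only [hD, hw, hD₀, hW₀]
    ring
  have hmain := alt_eq_of_alt_eq_metric_mul hG hy hn (Q := Q)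
    (fun a b c d e f => by simp only [hQ, hD, hw, hD₁ a b, hW₁ a b]; ring)
    (fun a b c d e f => by simp only [hQ, hD, hw, hD₂ a b c d, hW₂ a b c d]; ring) hQ₀ hX
  set J : Fin n → Fin n → Fin n → Fin n → ℝ := fun b f d e =>
    contract G y (fun i j => w b d e i * R f j) with hJ
  set K : Fin n → Fin n → Fin n → Fin n → ℝ := fun b f d e =>
    contract G y (fun i j => w b i f d * R e j) with hK
  have hJ' : ∀ b f d e, contract G y (fun i j => w i b d e * R j f) = J b f d e - J b f e d := by
    intro b f d e
    simp only [hJ]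
    rw [← contract_sub]
    congr 1
    funext i j
    have e1 := hW₄ b d e i
    have e2 := hW₂ b e d i
    have e3 := hW₁ i b d e
    rw [hR j f]
    simp only [hw]
    linear_combination (R f j) * (e3 + e2 - e1)
  have hK' : ∀ b f d e, contract G y (fun i j => w b f i d * R e j) = K b f d e - K f b d e := by
    intro b f d e
    simp only [hK]
    rw [← contract_sub]
    congr 1
    funext i j
    have e1 := hW₄ b i f d
    have e2 := hW₂ b f i d
    have e3 := hW₃ b d i f
    have e4 := hW₁ f i b d
    simp only [hw]
    linear_combination (R e j) * (- e1 + e2 - e3 + e4)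
  -- `F` consists of the terms common to both forms of the right hand side, `EL` is what the
  -- curvature terms look like when the traces of `Q` are written out, and `ER` is their final form.
  set F : Array33 n := fun a b f c d e =>
    1 / ((n : ℝ) - 4) * g a c * contract G y (fun i j => D b f d e i j)
    + 2 / ((n : ℝ) - 4) * g a c * contract G y (fun i j => D i b d e j f)
    + 2 / ((n : ℝ) - 4) * g a c * contract G y (fun i j => D b f i d e j)
    + 4 / (((n : ℝ) - 3) * ((n : ℝ) - 4)) * g a c * g b d *
        contract G y (fun i k => contract G y fun j l => D f i e j k l)
    - 4 / (((n : ℝ) - 2) * ((n : ℝ) - 3) * ((n : ℝ) - 4)) * g a c * g b d *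
        contract G y (fun i k => contract G y fun j l => w f i e j * R k l) with hF
  have hcurv := alt_curvature_terms g R w K J (1 / ((n : ℝ) - 4)) (1 / ((n : ℝ) - 2))
  set EL : Array33 n := fun a b f c d e =>
    -(1 / ((n : ℝ) - 2)) * (w a c d b - w a d c b) * R f e
        - 2 * (1 / ((n : ℝ) - 4)) * (1 / ((n : ℝ) - 2)) * g a c * (J b f d e - J b f e d)
        - 2 * (1 / ((n : ℝ) - 4)) * (1 / ((n : ℝ) - 2)) * g a c * (K b f d e - K f b d e) with hEL
  set ER : Array33 n := fun a b f c d e =>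
    - 2 * (1 / ((n : ℝ) - 2)) * w a c d b * R f e
        - 4 * (1 / ((n : ℝ) - 4)) * (1 / ((n : ℝ) - 2)) * g a c * K b f d e
        - 4 * (1 / ((n : ℝ) - 4)) * (1 / ((n : ℝ) - 2)) * g a c * J b f d e with hER
  have hR₀ : contract G y R = 0 := contract_tfRicci hG hy (by omega)
  have hleft : alt (fun a b f c d e => D a b c d e f) = alt (F + EL) := by
    have e1 : (fun a b f c d e => D a b c d e f) = (fun a b f c d e => Q a b c d e f) +
        fun a b f c d e => 1 / ((n : ℝ) - 2) * (w a b c d * R e f) := by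
      funext a b f c d e
      simp only [hQ, Pi.add_apply]
      ring
    rw [e1, alt.map_add, hmain, ← alt.map_add]
    congr 1
    funext a b f c d e
    have t1 : contract G y (fun i j => Q b f d e i j) = contract G y (fun i j => D b f d e i j) := by
      simp only [hQ]
      rw [contract_sub, contract_const_mul, contract_const_mul, hR₀]
      ring
    have t2 : contract G y (fun i j => Q i b d e j f) =
        contract G y (fun i j => D i b d e j f) - 1 / ((n : ℝ) - 2) * (J b f d e - J b f e d) := by
      simp only [hQ]
      rw [contract_sub, contract_const_mul, hJ']
    have t3 : contract G y (fun i j => Q b f i d e j) =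
        contract G y (fun i j => D b f i d e j) - 1 / ((n : ℝ) - 2) * (K b f d e - K f b d e) := by
      simp only [hQ]
      rw [contract_sub, contract_const_mul, hK']
    have t4 : contract G y (fun i k => contract G y fun j l => Q f i e j k l) =
        contract G y (fun i k => contract G y fun j l => D f i e j k l) - 1 / ((n : ℝ) - 2) *
          contract G y (fun i k => contract G y fun j l => w f i e j * R k l) := by
      simp only [hQ]
      rw [← contract_const_mul, ← contract_sub]
      congr 1
      funext i k
      rw [contract_sub, contract_const_mul]
    simp only [Pi.add_apply, t1, t2, t3, t4, hF, hEL]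
    rw [hwcyc a b c d, hR e f]
    field_simp
    ring
  have hright : alt (F + EL) = alt (F + ER) := by
    rw [alt.map_add, alt.map_add, hcurv]
  have hfin : alt (fun a b f c d e => D a b c d e f) = alt (fun a b f c d e =>
      1 / ((n : ℝ) - 4) * g a c * contract G y (fun i j => D b f d e i j)
      + 2 / ((n : ℝ) - 4) * g a c * contract G y (fun i j => D i b d e j f)
      + 2 / ((n : ℝ) - 4) * g a c * contract G y (fun i j => D b f i d e j)
      + 4 / (((n : ℝ) - 3) * ((n : ℝ) - 4)) * g a c * g b d *
        contract G y (fun i k => contract G y fun j l => D f i e j k l)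
      - 2 / ((n : ℝ) - 2) * w a c d b * R f e
      - 4 / (((n : ℝ) - 2) * ((n : ℝ) - 4)) * g a c * K b f d e
      - 4 / (((n : ℝ) - 2) * ((n : ℝ) - 4)) * g a c * J b f d e
      - 4 / (((n : ℝ) - 2) * ((n : ℝ) - 3) * ((n : ℝ) - 4)) * g a c * g b d *
        contract G y (fun i k => contract G y fun j l => w f i e j * R k l)) := by
    refine (hleft.trans hright).trans (congrArg alt ?_)
    funext a b f c d e
    simp only [Pi.add_apply, hF, hER]
    field_simp
    ring
  exact fun a b f c d e =>
    congrFun (congrFun (congrFun (congrFun (congrFun (congrFun hfin a) b) f) c) d) e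

end SecondOrderCondition

/-! ### Derivatives of the Ricci identity for the potential -/

section Potential

variable {n k : ℕ} {G : Components n 2} {U : Set (Coord n)} {y : Coord n}

theorem timesDifferentiableOn_contract (hG : IsMetricOn G U) {r : ℕ}
    {F : Fin n → Fin n → Coord n → ℝ} (hF : ∀ i j, TimesDifferentiableOn r (F i j) U) :
    TimesDifferentiableOn r (fun y => contract G y fun i j => F i j y) U :=
  .sum hG.isOpen Finset.univ fun i _ => .sum hG.isOpen Finset.univ fun j _ =>
    .mul hG.isOpen (hG.timesDifferentiableOn_invMetric r i j) (hF i j)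

/-- Covariant differentiation preserves a symmetry `T_{σ(I)} = c T_I` under a permutation `σ` of
the indices; `σ'` extends `σ` by the index of differentiation. -/
theorem covD_comp_eq (hU : IsOpen U) {T : Components n k}
    (hT : ∀ I, DifferentiableOn ℝ (T I) U) (c : ℝ) (σ : Fin k → Fin k)
    (σ' : Fin (k + 1) → Fin (k + 1)) (h : ∀ y ∈ U, ∀ I, T (I ∘ σ) y = c * T I y)
    (hbij : Function.Bijective σ := by decide)
    (hσ' : σ' = Fin.snoc (α := fun _ => Fin (k + 1)) (Fin.castSucc ∘ σ) (Fin.last k) := by decide) :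
    ∀ y ∈ U, ∀ J, covD G T (J ∘ σ') y = c * covD G T J y := by
  intro y hy J
  have hT' : HasCovDOn G U T (covD G T) := ⟨hT, fun _ _ _ => rfl⟩
  rw [← (hT'.reindex σ σ' hbij hσ').covD_eq y hy J]
  exact ((hT'.const_mul hU c).congr hU h).covD_eq y hy J

theorem eta_two {α : Type*} (I : Fin 2 → α) : ![I 0, I 1] = I := by
  ext i; fin_cases i <;> rfl

theorem eta_three {α : Type*} (I : Fin 3 → α) : ![I 0, I 1, I 2] = I := by
  ext i; fin_cases i <;> rfl

theorem eta_four {α : Type*} (I : Fin 4 → α) : ![I 0, I 1, I 2, I 3] = I := by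
  ext i; fin_cases i <;> rfl

theorem eta_five {α : Type*} (I : Fin 5 → α) : ![I 0, I 1, I 2, I 3, I 4] = I := by
  ext i; fin_cases i <;> rfl

theorem snoc_snoc_three {α : Type*} (a b c d e : α) :
    (![a, b, c, d, e] : Fin 5 → α) =
      Fin.snoc (α := fun _ => α) (Fin.snoc (α := fun _ => α) ![a, b, c] d) e := by
  ext i; fin_cases i <;> rfl

theorem snoc_snoc_four {α : Type*} (a b c d e f : α) :
    (![a, b, c, d, e, f] : Fin 6 → α) =
      Fin.snoc (α := fun _ => α) (Fin.snoc (α := fun _ => α) ![a, b, c, d] e) f := by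
  ext i; fin_cases i <;> rfl

/-- The second covariant derivative of a trace-free tensor field is trace-free in the original
indices. -/
theorem contract_covD_eq_zero (hG : IsMetricOn G U) {T : Components n 4}
    (hT : ∀ I, TimesDifferentiableOn 2 (T I) U)
    (h : ∀ y ∈ U, ∀ b d, contract G y (fun i j => T ![i, b, j, d] y) = 0) (hy : y ∈ U)
    (b d e f : Fin n) :
    contract G y (fun i j => covD G (covD G T) ![i, b, j, d, e, f] y) = 0 := by
  have h1 : ∀ y ∈ U, ∀ I : Fin 4 → Fin n, ∑ i, ∑ j, invMetric G y i j *
      T (Function.update (Function.update I 0 i) 2 j) y = 0 := by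
    intro y hy I
    rw [← h y hy (I 1) (I 3)]
    refine Finset.sum_congr rfl fun i _ => Finset.sum_congr rfl fun j _ => ?_
    refine congrArg (fun I => invMetric G y i j * T I y) ?_
    ext l; fin_cases l <;> rfl
  have h2 := fun y hy => sum_invMetric_covD_eq_zero hG (fun I => (hT I).1) (y := y) (by decide) h1 hy
  have h3 := sum_invMetric_covD_eq_zero hG
    (fun J => (timesDifferentiableOn_covD hG hT J).1) (by decide) h2 hy ![b, b, b, d, e, f]
  rw [← h3]
  refine Finset.sum_congr rfl fun i _ => Finset.sum_congr rfl fun j _ => ?_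
  refine congrArg (fun I => invMetric G y i j * covD G (covD G T) I y) ?_
  ext l; fin_cases l <;> rfl

/-- The derivative of the Ricci identity for a tensor field of rank three, for vanishing Weyl
tensor. -/
theorem exists_covD_ricci_identity (hG : IsMetricOn G U) (hn : 3 ≤ n)
    (hC : ∀ y ∈ U, ∀ a b c d, weyl G a b c d y = 0) {L : Components n 3}
    (hL : ∀ I, TimesDifferentiableOn 3 (L I) U) (hy : y ∈ U) :
    ∃ V₁ V₂ V₃ : Fin n → Fin n → Fin n → Fin n → ℝ,
      let g : Fin n → Fin n → ℝ := fun a b => G ![a, b] y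
      let P : Fin n → Fin n → ℝ := fun a b => schouten G ![a, b] y
      let P' : Fin n → Fin n → Fin n → ℝ := fun a b c => covD G (schouten G) ![a, b, c] y
      let l : Fin n → Fin n → Fin n → ℝ := fun a b c => L ![a, b, c] y
      let l' : Fin n → Fin n → Fin n → Fin n → ℝ := fun a b c d => covD G L ![a, b, c, d] y
      ∀ a b c d e f, covD G (covD G (covD G L)) ![a, b, c, d, e, f] y -
          covD G (covD G (covD G L)) ![a, b, c, e, d, f] y =
        (P' a d f * l e b c + P a d * l' e b c f - (P' a e f * l d b c + P a e * l' d b c f)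
          + g a d * V₁ e b c f - g a e * V₁ d b c f)
        + (P' b d f * l a e c + P b d * l' a e c f - (P' b e f * l a d c + P b e * l' a d c f)
          + g b d * V₂ a e c f - g b e * V₂ a d c f)
        + (P' c d f * l a b e + P c d * l' a b e f - (P' c e f * l a b d + P c e * l' a b d f)
          + g c d * V₃ a b e f - g c e * V₃ a b d f) := by
  have hU := hG.isOpen
  have hL1 : ∀ I, TimesDifferentiableOn 1 (L I) U := fun I => (hL I).of_succ.of_succ
  have hPL : ∀ p e I, TimesDifferentiableOn 1 (fun y => schouten G ![p, e] y * L I y) U :=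
    fun p e I => .mul hU (timesDifferentiableOn_schouten hG 1 _) (hL1 I)
  set V₁ : Components n 3 := fun I y =>
    contract G y fun m p => schouten G ![p, I 0] y * L ![m, I 1, I 2] y with hV₁
  set V₂ : Components n 3 := fun I y =>
    contract G y fun m p => schouten G ![p, I 1] y * L ![I 0, m, I 2] y with hV₂
  set V₃ : Components n 3 := fun I y =>
    contract G y fun m p => schouten G ![p, I 2] y * L ![I 0, I 1, m] y with hV₃
  have dP : HasCovDOn G U (schouten G) _ := hasCovDOn (timesDifferentiableOn_schouten hG 1)
  have dL : HasCovDOn G U L _ := hasCovDOn hL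
  have dV₁ : HasCovDOn G U V₁ _ := hasCovDOn (r := 0) fun I =>
    timesDifferentiableOn_contract hG fun _ _ => hPL _ _ _
  have dV₂ : HasCovDOn G U V₂ _ := hasCovDOn (r := 0) fun I =>
    timesDifferentiableOn_contract hG fun _ _ => hPL _ _ _
  have dV₃ : HasCovDOn G U V₃ _ := hasCovDOn (r := 0) fun I =>
    timesDifferentiableOn_contract hG fun _ _ => hPL _ _ _
  -- The covariant derivatives of the three groups of terms in the Ricci identity, one for each
  -- index of `L`.
  have s₁ := (((dP.mul hU dL (k := 5) ![0, 3] ![4, 1, 2] ![0, 3] ![4, 1, 2] ![0, 3, 5]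
    ![4, 1, 2, 5]).sub hU (dP.mul hU dL ![0, 4] ![3, 1, 2] ![0, 4] ![3, 1, 2] ![0, 4, 5]
    ![3, 1, 2, 5])).add hU (dV₁.metric_mul hG ![0, 3] ![4, 1, 2] ![0, 3] ![4, 1, 2, 5])).sub hU
    (dV₁.metric_mul hG ![0, 4] ![3, 1, 2] ![0, 4] ![3, 1, 2, 5])
  have s₂ := (((dP.mul hU dL (k := 5) ![1, 3] ![0, 4, 2] ![1, 3] ![0, 4, 2] ![1, 3, 5]
    ![0, 4, 2, 5]).sub hU (dP.mul hU dL ![1, 4] ![0, 3, 2] ![1, 4] ![0, 3, 2] ![1, 4, 5]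
    ![0, 3, 2, 5])).add hU (dV₂.metric_mul hG ![1, 3] ![0, 4, 2] ![1, 3] ![0, 4, 2, 5])).sub hU
    (dV₂.metric_mul hG ![1, 4] ![0, 3, 2] ![1, 4] ![0, 3, 2, 5])
  have s₃ := (((dP.mul hU dL (k := 5) ![2, 3] ![0, 1, 4] ![2, 3] ![0, 1, 4] ![2, 3, 5]
    ![0, 1, 4, 5]).sub hU (dP.mul hU dL ![2, 4] ![0, 1, 3] ![2, 4] ![0, 1, 3] ![2, 4, 5]
    ![0, 1, 3, 5])).add hU (dV₃.metric_mul hG ![2, 3] ![0, 1, 4] ![2, 3] ![0, 1, 4, 5])).sub hU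
    (dV₃.metric_mul hG ![2, 4] ![0, 1, 3] ![2, 4] ![0, 1, 3, 5])
  have hK := (s₁.add hU s₂).add hU s₃
  have dDD : HasCovDOn G U (covD G (covD G L)) _ := hasCovDOn (r := 0)
    (timesDifferentiableOn_covD hG (timesDifferentiableOn_covD hG hL))
  have hcomm := dDD.sub hU (dDD.reindex ![0, 1, 2, 4, 3] ![0, 1, 2, 4, 3, 5])
  have hid : HasCovDOn G U (fun I y => covD G (covD G L) I y -
      covD G (covD G L) (I ∘ ![0, 1, 2, 4, 3]) y) _ := hK.congr hU fun y hy I => by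
    rw [← eta_five I]
    generalize I 0 = a, I 1 = b, I 2 = c, I 3 = d, I 4 = e
    simp only [comp_vecCons, comp_vecEmpty, Matrix.cons_val]
    have u0 : ∀ x, Function.update ![a, b, c] 0 x = ![x, b, c] := fun x => by
      ext l; fin_cases l <;> rfl
    have u1 : ∀ x, Function.update ![a, b, c] 1 x = ![a, x, c] := fun x => by
      ext l; fin_cases l <;> rfl
    have u2 : ∀ x, Function.update ![a, b, c] 2 x = ![a, b, x] := fun x => by
      ext l; fin_cases l <;> rfl
    rw [snoc_snoc_three, snoc_snoc_three, covD_covD_sub_of_weyl_eq_zero hG hn (hC y hy)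
      (fun I => (hL I).of_succ) hy, Fin.sum_univ_three]
    simp only [u0, u1, u2, hV₁, hV₂, hV₃, Matrix.cons_val]
  refine ⟨fun a b c d => covD G V₁ ![a, b, c, d] y, fun a b c d => covD G V₂ ![a, b, c, d] y,
    fun a b c d => covD G V₃ ![a, b, c, d] y, fun a b c d e f => ?_⟩
  have h := (hcomm.covD_eq y hy ![a, b, c, d, e, f]).symm.trans
    (hid.covD_eq y hy ![a, b, c, d, e, f])
  simp only [comp_vecCons, comp_vecEmpty, Matrix.cons_val] at h
  exact h

end Potential

/-! ### The second order condition in a coordinate domain -/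

section LocalTheorem

variable {n : ℕ} {G : Components n 2} {U : Set (Coord n)} {y : Coord n}

/-- The Ricci identity for a tensor field of rank four, for vanishing Weyl tensor. -/
theorem exists_ricci_identity_four (hG : IsMetricOn G U) (hn : 3 ≤ n)
    (hC : ∀ y ∈ U, ∀ a b c d, weyl G a b c d y = 0) {T : Components n 4}
    (hT : ∀ I, TimesDifferentiableOn 2 (T I) U) (hy : y ∈ U) :
    ∃ Y₁ Y₂ Y₃ Y₄ : Fin n → Fin n → Fin n → Fin n → ℝ,
      let g : Fin n → Fin n → ℝ := fun a b => G ![a, b] y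
      let P : Fin n → Fin n → ℝ := fun a b => schouten G ![a, b] y
      let t : Fin n → Fin n → Fin n → Fin n → ℝ := fun a b c d => T ![a, b, c, d] y
      ∀ a b c d e f, covD G (covD G T) ![a, b, c, d, e, f] y -
          covD G (covD G T) ![a, b, c, d, f, e] y =
        (P a e * t f b c d - P a f * t e b c d + g a e * Y₁ f b c d - g a f * Y₁ e b c d)
        + (P b e * t a f c d - P b f * t a e c d + g b e * Y₂ a f c d - g b f * Y₂ a e c d)
        + (P c e * t a b f d - P c f * t a b e d + g c e * Y₃ a b f d - g c f * Y₃ a b e d)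
        + (P d e * t a b c f - P d f * t a b c e + g d e * Y₄ a b c f - g d f * Y₄ a b c e) := by
  refine ⟨fun f b c d => contract G y fun m p => schouten G ![p, f] y * T ![m, b, c, d] y,
    fun a f c d => contract G y fun m p => schouten G ![p, f] y * T ![a, m, c, d] y,
    fun a b f d => contract G y fun m p => schouten G ![p, f] y * T ![a, b, m, d] y,
    fun a b c f => contract G y fun m p => schouten G ![p, f] y * T ![a, b, c, m] y,
    fun a b c d e f => ?_⟩
  have u0 : ∀ x, Function.update ![a, b, c, d] 0 x = ![x, b, c, d] := fun x => by
    ext l; fin_cases l <;> rfl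
  have u1 : ∀ x, Function.update ![a, b, c, d] 1 x = ![a, x, c, d] := fun x => by
    ext l; fin_cases l <;> rfl
  have u2 : ∀ x, Function.update ![a, b, c, d] 2 x = ![a, b, x, d] := fun x => by
    ext l; fin_cases l <;> rfl
  have u3 : ∀ x, Function.update ![a, b, c, d] 3 x = ![a, b, c, x] := fun x => by
    ext l; fin_cases l <;> rfl
  rw [snoc_snoc_four, snoc_snoc_four, covD_covD_sub_of_weyl_eq_zero hG hn (hC y hy) hT hy,
    Fin.sum_univ_four]
  simp only [u0, u1, u2, u3, Matrix.cons_val]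

/-- The trace terms in the expression of a Weyl candidate through a potential are the
Kulkarni-Nomizu product of the metric with a tensor field of rank two. -/
theorem exists_trace_part (hG : IsMetricOn G U) (hn : 3 ≤ n) {L : Components n 3}
    {W : Components n 4} (hL : ∀ I, TimesDifferentiableOn 3 (L I) U)
    (hW : ∀ y ∈ U, PotentialEquationAt G L W y) :
    ∃ S : Components n 2, (∀ I, TimesDifferentiableOn 2 (S I) U) ∧ ∀ y ∈ U, ∀ I, W I y =
      covD G L I y - covD G L (I ∘ ![0, 1, 3, 2]) y + covD G L (I ∘ ![2, 3, 0, 1]) y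
        - covD G L (I ∘ ![2, 3, 1, 0]) y
      + G (I ∘ ![0, 2]) y * S (I ∘ ![1, 3]) y - G (I ∘ ![0, 3]) y * S (I ∘ ![1, 2]) y
      - G (I ∘ ![1, 2]) y * S (I ∘ ![0, 3]) y + G (I ∘ ![1, 3]) y * S (I ∘ ![0, 2]) y := by
  have hn' : (3 : ℝ) ≤ n := by exact_mod_cast hn
  have h1 : (n : ℝ) - 1 ≠ 0 := by linarith
  have h2 : (n : ℝ) - 2 ≠ 0 := by linarith
  have hU := hG.isOpen
  have hD := fun J => timesDifferentiableOn_covD hG hL J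
  refine ⟨fun I y => - (1 / ((n : ℝ) - 2)) * (
      contract G y (fun i j => covD G L ![I 0, i, I 1, j] y)
      - contract G y (fun i j => covD G L ![I 0, i, j, I 1] y)
      + contract G y (fun i j => covD G L ![I 1, i, I 0, j] y)
      - contract G y (fun i j => covD G L ![I 1, i, j, I 0] y))
      + 2 / (((n : ℝ) - 2) * ((n : ℝ) - 1)) * (G I y *
        contract G y (fun i k => contract G y fun j l => covD G L ![i, j, k, l] y)), fun I => ?_,
    fun y hy I => ?_⟩
  · have hc : ∀ F : Fin n → Fin n → Fin 4 → Fin n,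
        TimesDifferentiableOn 2 (fun y => contract G y fun i j => covD G L (F i j) y) U :=
      fun F => timesDifferentiableOn_contract hG fun i j => hD _
    exact .add hU (.const_mul hU _ (.sub hU (.add hU (.sub hU (hc _) (hc _)) (hc _)) (hc _)))
      (.const_mul hU _ (.mul hU (hG.timesDifferentiableOn 2 I)
        (timesDifferentiableOn_contract hG fun i k => hc _)))
  · have h := hW y hy (I 0) (I 1) (I 2) (I 3)
    rw [eta_four] at h
    rw [h]
    conv_rhs => rw [← eta_four I]
    generalize I 0 = a, I 1 = b, I 2 = c, I 3 = d
    simp only [comp_vecCons, comp_vecEmpty, Matrix.cons_val, asym2]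
    field_simp
    ring

/-- A tensor field which is given by a three times differentiable potential is twice
differentiable. -/
theorem timesDifferentiableOn_of_potential (hG : IsMetricOn G U) (hn : 3 ≤ n) {L : Components n 3}
    {W : Components n 4} (hL : ∀ I, TimesDifferentiableOn 3 (L I) U)
    (hW : ∀ y ∈ U, PotentialEquationAt G L W y) (I : Fin 4 → Fin n) :
    TimesDifferentiableOn 2 (W I) U := by
  obtain ⟨S, hS, h⟩ := exists_trace_part hG hn hL hW
  have hU := hG.isOpen
  have hD := fun J => timesDifferentiableOn_covD hG hL J
  have hGS : ∀ I J, TimesDifferentiableOn 2 (fun y => G I y * S J y) U := fun I J =>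
    .mul hU (hG.timesDifferentiableOn 2 I) (hS J)
  exact TimesDifferentiableOn.congr hU (.add hU (.sub hU (.sub hU (.add hU (.sub hU (.add hU
    (.sub hU (hD _) (hD _)) (hD _)) (hD _)) (hGS _ _)) (hGS _ _)) (hGS _ _)) (hGS _ _))
    fun y hy => h y hy I

/-- The necessity of the second order condition, in a coordinate domain. -/
theorem secondOrderConditionAt_of_potential (hG : IsMetricOn G U) (hn : 5 ≤ n)
    (hC : ∀ y ∈ U, ∀ a b c d, weyl G a b c d y = 0) {L : Components n 3} {W : Components n 4}
    (hL : ∀ I, TimesDifferentiableOn 3 (L I) U)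
    (hLanti : ∀ y ∈ U, ∀ a b c, L ![a, b, c] y = - L ![b, a, c] y)
    (hW₁ : ∀ y ∈ U, ∀ a b c d, W ![b, a, c, d] y = - W ![a, b, c, d] y)
    (hW₂ : ∀ y ∈ U, ∀ a b c d, W ![a, b, d, c] y = - W ![a, b, c, d] y)
    (hW₃ : ∀ y ∈ U, ∀ a b c d, W ![c, d, a, b] y = W ![a, b, c, d] y)
    (hW₄ : ∀ y ∈ U, ∀ a b c d, W ![a, b, c, d] y + W ![a, c, d, b] y + W ![a, d, b, c] y = 0)
    (hW₀ : ∀ y ∈ U, ∀ b d, contract G y (fun i j => W ![i, b, j, d] y) = 0)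
    (hW : ∀ y ∈ U, PotentialEquationAt G L W y) (hy : y ∈ U) :
    SecondOrderConditionAt G W y := by
  have hU := hG.isOpen
  have hWd := timesDifferentiableOn_of_potential hG (by omega) hL hW
  have hP : ∀ y ∈ U, ∀ a b, schouten G ![a, b] y = schouten G ![b, a] y := fun y hy =>
    schouten_symm hG (by omega) (hC y hy) hy
  have hP' : ∀ a b c, covD G (schouten G) ![a, b, c] y = covD G (schouten G) ![b, a, c] y := by
    intro a b c
    have := covD_comp_eq (G := G) hU (fun I => (timesDifferentiableOn_schouten hG 1 I).1) 1 ![1, 0]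
      ![1, 0, 2] (fun y hy I => by
        rw [← eta_two I, one_mul]
        simp only [comp_vecCons, comp_vecEmpty, Matrix.cons_val]
        exact hP y hy _ _) (by decide) (by decide) y hy ![b, a, c]
    simpa only [comp_vecCons, comp_vecEmpty, Matrix.cons_val, one_mul] using this
  have hL' : ∀ a b c d, covD G L ![a, b, c, d] y = - covD G L ![b, a, c, d] y := by
    intro a b c d
    have := covD_comp_eq (G := G) hU (fun I => (hL I).1) (-1) ![1, 0, 2]
      ![1, 0, 2, 3] (fun y hy I => by
        rw [← eta_three I, neg_one_mul]
        simp only [comp_vecCons, comp_vecEmpty, Matrix.cons_val]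
        exact hLanti y hy _ _ _) (by decide) (by decide) y hy ![b, a, c, d]
    simpa only [comp_vecCons, comp_vecEmpty, Matrix.cons_val, neg_one_mul] using this
  have hD₁ : ∀ a b c d e f, covD G (covD G W) ![b, a, c, d, e, f] y =
      - covD G (covD G W) ![a, b, c, d, e, f] y := by
    intro a b c d e f
    have h1 := covD_comp_eq (G := G) hU (fun I => (hWd I).1) (-1) ![1, 0, 2, 3]
      ![1, 0, 2, 3, 4] fun y hy I => by
        rw [← eta_four I, neg_one_mul]
        simp only [comp_vecCons, comp_vecEmpty, Matrix.cons_val]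
        exact hW₁ y hy _ _ _ _
    have h2 := covD_comp_eq (G := G) hU (fun J => (timesDifferentiableOn_covD hG hWd J).1) (-1) _
      ![1, 0, 2, 3, 4, 5] h1 (by decide) (by decide) y hy ![a, b, c, d, e, f]
    simpa only [comp_vecCons, comp_vecEmpty, Matrix.cons_val, neg_one_mul] using h2
  have hD₂ : ∀ a b c d e f, covD G (covD G W) ![a, b, d, c, e, f] y =
      - covD G (covD G W) ![a, b, c, d, e, f] y := by
    intro a b c d e f
    have h1 := covD_comp_eq (G := G) hU (fun I => (hWd I).1) (-1) ![0, 1, 3, 2]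
      ![0, 1, 3, 2, 4] fun y hy I => by
        rw [← eta_four I, neg_one_mul]
        simp only [comp_vecCons, comp_vecEmpty, Matrix.cons_val]
        exact hW₂ y hy _ _ _ _
    have h2 := covD_comp_eq (G := G) hU (fun J => (timesDifferentiableOn_covD hG hWd J).1) (-1) _
      ![0, 1, 3, 2, 4, 5] h1 (by decide) (by decide) y hy ![a, b, c, d, e, f]
    simpa only [comp_vecCons, comp_vecEmpty, Matrix.cons_val, neg_one_mul] using h2
  refine secondOrderConditionAt_of_altModTrace hG hy hn (hP y hy) (hW₁ y hy) (hW₂ y hy) (hW₃ y hy)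
    (hW₄ y hy) (hW₀ y hy) hD₁ hD₂ (contract_covD_eq_zero hG hWd hW₀ hy) fun Φ hΦ => ?_
  obtain ⟨S, hS, hWS⟩ := exists_trace_part hG (by omega) hL hW
  obtain ⟨s, hs⟩ := exists_covD_schouten_sub_eq hG (by omega) hC hy
  obtain ⟨V₁, V₂, V₃, hK⟩ := exists_covD_ricci_identity hG (by omega) hC hL hy
  obtain ⟨Y₁, Y₂, Y₃, Y₄, hK'⟩ := exists_ricci_identity_four hG (by omega) hC
    (timesDifferentiableOn_covD hG hL) hy
  -- The second covariant derivative of the expression of `W` through `L`.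
  have dL : HasCovDOn G U (covD G L) _ := hasCovDOn (r := 1) (timesDifferentiableOn_covD hG hL)
  have dL₂ : HasCovDOn G U (covD G (covD G L)) _ := hasCovDOn (r := 0)
    (timesDifferentiableOn_covD hG (timesDifferentiableOn_covD hG hL))
  have dS : HasCovDOn G U S _ := hasCovDOn hS
  have dS₂ : HasCovDOn G U (covD G S) _ := hasCovDOn (timesDifferentiableOn_covD hG hS)
  have dW : HasCovDOn G U W _ := ((((((((dL.sub hU
    (dL.reindex ![0, 1, 3, 2] ![0, 1, 3, 2, 4])).add hU
    (dL.reindex ![2, 3, 0, 1] ![2, 3, 0, 1, 4])).sub hU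
    (dL.reindex ![2, 3, 1, 0] ![2, 3, 1, 0, 4])).add hU
    (dS.metric_mul hG (k := 4) ![0, 2] ![1, 3] ![0, 2] ![1, 3, 4])).sub hU
    (dS.metric_mul hG ![0, 3] ![1, 2] ![0, 3] ![1, 2, 4])).sub hU
    (dS.metric_mul hG ![1, 2] ![0, 3] ![1, 2] ![0, 3, 4])).add hU
    (dS.metric_mul hG ![1, 3] ![0, 2] ![1, 3] ![0, 2, 4])).congr hU hWS)
  have dW₂ : HasCovDOn G U (covD G W) _ := ((((((((dL₂.sub hU
    (dL₂.reindex ![0, 1, 3, 2, 4] ![0, 1, 3, 2, 4, 5])).add hU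
    (dL₂.reindex ![2, 3, 0, 1, 4] ![2, 3, 0, 1, 4, 5])).sub hU
    (dL₂.reindex ![2, 3, 1, 0, 4] ![2, 3, 1, 0, 4, 5])).add hU
    (dS₂.metric_mul hG (k := 5) ![0, 2] ![1, 3, 4] ![0, 2] ![1, 3, 4, 5])).sub hU
    (dS₂.metric_mul hG ![0, 3] ![1, 2, 4] ![0, 3] ![1, 2, 4, 5])).sub hU
    (dS₂.metric_mul hG ![1, 2] ![0, 3, 4] ![1, 2] ![0, 3, 4, 5])).add hU
    (dS₂.metric_mul hG ![1, 3] ![0, 2, 4] ![1, 3] ![0, 2, 4, 5])).congr hU dW.covD_eq)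
  refine map_second_derivative hΦ (hG.symm y hy) (hP y hy) hP' (hLanti y hy) hL' hs hK hK'
    (W := fun a b c d => W ![a, b, c, d] y) (S := fun a b => S ![a, b] y)
    (S₂ := fun a b c d => covD G (covD G S) ![a, b, c, d] y) (fun a b c d => ?_)
    (W₂ := fun a b c d e f => covD G (covD G W) ![a, b, c, d, e, f] y) fun a b c d e f => ?_
  · have h := hWS y hy ![a, b, c, d]
    simp only [comp_vecCons, comp_vecEmpty, Matrix.cons_val] at h
    exact h
  · have h := dW₂.covD_eq y hy ![a, b, c, d, e, f]
    simp only [comp_vecCons, comp_vecEmpty, Matrix.cons_val] at h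
    exact h

end LocalTheorem

/-! ### From coordinate domains to the manifold -/

section ManifoldCharts

variable {n : ℕ} {M : Type*} [TopologicalSpace M] [ChartedSpace (EuclideanSpace ℝ (Fin n)) M]

/-- The metric at `x`, as a bilinear form on the tangent space. -/
def Metric.toBilin (g : Metric n M) (x : M) : LinearMap.BilinForm ℝ (TangentSpace (𝓡 n) x) :=
  have add : ∀ u v w, g.val x ![u + v, w] = g.val x ![u, w] + g.val x ![v, w] :=
    fun u v w => (g.val x).cons_add ![w] u v
  have smul : ∀ (c : ℝ) u w, g.val x ![c • u, w] = c • g.val x ![u, w] :=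
    fun c u w => (g.val x).cons_smul ![w] c u
  LinearMap.mk₂ ℝ (fun u v => g.val x ![u, v]) add smul
    (fun u v w => by rw [g.symm, add, g.symm x v, g.symm x w])
    (fun c u w => by rw [g.symm, smul, g.symm x w])

theorem mfderiv_symm_eq_sum_coordVector
    (e : OpenPartialHomeomorph M (EuclideanSpace ℝ (Fin n))) (y : Coord n) (v : Coord n) :
    (mfderiv (𝓡 n) (𝓡 n) e.symm y v : TangentSpace (𝓡 n) (e.symm y)) =
      ∑ i, v i • coordVector e y i := by
  have h : v = ∑ i, v i • (EuclideanSpace.single i (1 : ℝ) : EuclideanSpace ℝ (Fin n)) := by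
    simpa using ((EuclideanSpace.basisFun (Fin n) ℝ).sum_repr v).symm
  have h2 := congrArg (mfderiv (𝓡 n) (𝓡 n) e.symm y : Coord n → _) h
  refine h2.trans ?_
  refine (map_sum (mfderiv (𝓡 n) (𝓡 n) e.symm y) _ _).trans ?_
  exact Finset.sum_congr rfl fun i _ => map_smul (mfderiv (𝓡 n) (𝓡 n) e.symm y) (v i) _

theorem CovTensorField.comp_vec_two (T : CovTensorField n M 2)
    (e : OpenPartialHomeomorph M (EuclideanSpace ℝ (Fin n))) (y : Coord n) (a b : Fin n) :
    T.comp e ![a, b] y = T (e.symm y) ![coordVector e y a, coordVector e y b] :=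
  congrArg (T (e.symm y)) <| funext fun i => by fin_cases i <;> rfl

theorem CovTensorField.comp_vec_three (T : CovTensorField n M 3)
    (e : OpenPartialHomeomorph M (EuclideanSpace ℝ (Fin n))) (y : Coord n) (a b c : Fin n) :
    T.comp e ![a, b, c] y =
      T (e.symm y) ![coordVector e y a, coordVector e y b, coordVector e y c] :=
  congrArg (T (e.symm y)) <| funext fun i => by fin_cases i <;> rfl

theorem CovTensorField.comp_vec_four (T : CovTensorField n M 4)
    (e : OpenPartialHomeomorph M (EuclideanSpace ℝ (Fin n))) (y : Coord n) (a b c d : Fin n) :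
    T.comp e ![a, b, c, d] y = T (e.symm y)
      ![coordVector e y a, coordVector e y b, coordVector e y c, coordVector e y d] :=
  congrArg (T (e.symm y)) <| funext fun i => by fin_cases i <;> rfl

theorem mdifferentiable_of_mem_smoothCharts
    {e : OpenPartialHomeomorph M (EuclideanSpace ℝ (Fin n))} (he : e ∈ smoothCharts n M) :
    e.MDifferentiable (𝓡 n) (𝓡 n) :=
  ⟨(contMDiffOn_of_mem_maximalAtlas he).mdifferentiableOn (by simp),
    (contMDiffOn_symm_of_mem_maximalAtlas he).mdifferentiableOn (by simp)⟩

/-- The components of a metric in a smooth chart form a nonsingular matrix, since the coordinate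
vectors span the tangent space. -/
theorem Metric.isMetricOn (g : Metric n M)
    {e : OpenPartialHomeomorph M (EuclideanSpace ℝ (Fin n))} (he : e ∈ smoothCharts n M) :
    IsMetricOn (g.val.comp e) e.target where
  isOpen := e.open_target
  contDiffOn := g.smooth e he
  symm y _ a b := by rw [CovTensorField.comp_vec_two, CovTensorField.comp_vec_two, g.symm]
  isUnit_det y hy := by
    rw [isUnit_iff_ne_zero]
    intro hdet
    obtain ⟨v, hv, h⟩ := Matrix.exists_mulVec_eq_zero_iff.2 hdet
    have hbij := (mdifferentiable_of_mem_smoothCharts he).symm.mfderiv_bijective hy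
    -- A vector in the kernel of the matrix is orthogonal to every coordinate vector.
    have hu : ∀ a, g.toBilin _ (coordVector e y a)
        (mfderiv (𝓡 n) (𝓡 n) e.symm y (WithLp.toLp 2 v : Coord n)) = 0 := by
      intro a
      rw [mfderiv_symm_eq_sum_coordVector, map_sum]
      refine (Finset.sum_congr rfl fun b _ => ?_).trans (congrFun h a)
      rw [map_smul, smul_eq_mul, mul_comm]
      exact congrArg (· * v b) (g.val.comp_vec_two e y a b).symm
    have hz : mfderiv (𝓡 n) (𝓡 n) e.symm y (WithLp.toLp 2 v : Coord n) = 0 := by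
      refine g.nondegenerate _ _ fun w => ?_
      obtain ⟨w, rfl⟩ := hbij.2 w
      rw [g.symm]
      change g.toBilin _ _ _ = 0
      rw [mfderiv_symm_eq_sum_coordVector e y w, map_sum, LinearMap.sum_apply]
      refine Finset.sum_eq_zero fun a _ => ?_
      rw [map_smul, LinearMap.smul_apply, hu, smul_zero]
    have h0 := hbij.1 (hz.trans (map_zero _).symm)
    exact hv (congrArg WithLp.ofLp h0)

end ManifoldCharts

end Lanczos

end

theorem theorem3 {n : ℕ} (hn : 6 ≤ n) {M : Type*} [TopologicalSpace M]
    [ChartedSpace (EuclideanSpace ℝ (Fin n)) M] [IsManifold (𝓡 n) ∞ M]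
    (g : Lanczos.Metric n M) (hg : g.WeylVanishes)
    (W : Lanczos.CovTensorField n M 4) (hW : Lanczos.IsWeylCandidate g W)
    (hfail : ¬ Lanczos.SatisfiesSecondOrderCondition g W) :
    ¬ ∃ L : Lanczos.CovTensorField n M 3,
        Lanczos.HasLanczosSymmetries L ∧ L.TimesDifferentiable 3 ∧ Lanczos.IsGivenBy g W L := by
  rintro ⟨L, hLsymm, hL, hWL⟩
  refine hfail ⟨fun e he => Lanczos.timesDifferentiableOn_of_potential (g.isMetricOn he)
    (by omega) (hL e he) (hWL e he), fun e he y hy =>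
    Lanczos.secondOrderConditionAt_of_potential (L := L.comp e) (g.isMetricOn he) (by omega)
      (hg e he) (hL e he)
      (fun y _ a b c => ?_) (fun y _ a b c d => ?_) (fun y _ a b c d => ?_)
      (fun y _ a b c d => ?_) (fun y _ a b c d => ?_) (fun y hy b d => hW.trace_free e he y hy b d)
      (hWL e he) hy⟩
  · simp only [Lanczos.CovTensorField.comp_vec_three]
    exact hLsymm.antisymm _ _ _ _
  · simp only [Lanczos.CovTensorField.comp_vec_four]
    exact hW.antisymm_left _ _ _ _ _
  · simp only [Lanczos.CovTensorField.comp_vec_four]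
    exact hW.antisymm_right _ _ _ _ _
  · simp only [Lanczos.CovTensorField.comp_vec_four]
    exact hW.pair_symm _ _ _ _ _
  · simp only [Lanczos.CovTensorField.comp_vec_four]
    exact hW.cyclic _ _ _ _ _
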